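/- **Setup.** A partition $\lambda=(\lambda_1\ge\lambda_2\ge\dots)$ is identified with its Young diagram; $l(\lambda)$ is its number of nonzero parts, $|\lambda|$ its number of boxes, $\lambda'$ its conjugate, and $h(\lambda)$ the product of the hook lengths of its boxes. Write $(k^l)$ for the partition with $l$ parts equal to $k$, $\lambda+\mu$ for the partition with parts $\lambda_i+\mu_i$, and $\lambda\cup\mu$ for the partition obtained by appending the parts of $\mu$ after those of $\lambda$ (when this is again a partition). For non-negative integers $m,n,s$ let $$Z_{m,n,s}=\sum_{l(\lambda)\le m+n}\frac{1}{h(\lambda)\,h(\lambda+(s^{m+n}))},\qquad P_{m,n,s}(\lambda)=\frac{1}{Z_{m,n,s}\,h(\lambda)\,h(\lambda+(s^{m+n}))}\quad(l(\lambda)\le m+n),$$ $$Q_{m,n,s}(\mu,\nu)=\frac{h((m^n))}{Z_{m,n,s}\,h(\mu)\,h(\nu+(s^n))\,h\big((\mu+(s^m)+(n^m))\cup\nu'\big)}\quad(l(\mu)\le m,\ l(\nu)\le n),$$ and let $P_{m,n,s}$, $Q_{m,n,s}$ vanish on all other partitions, respectively pairs of partitions. The Poissonized Plancherel measure with parameter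 $t\ge 0$ is the probability measure on partitions with mass $e^{-t}t^{|\lambda|}/h(\lambda)^2$ at $\lambda$ (with $0^0=1$). **Proposition.** Let $m,n\to\infty$, and suppose that one of the following holds. 1. $s\to\infty$ with $s/m\to\alpha$ and $s/n\to\beta$, where $\alpha,\beta\in[0,\infty)$ are not both zero; put $$\gamma=\frac{\beta}{\alpha\beta+\alpha+\beta},\qquad \delta=\frac{\alpha}{\alpha\beta+\alpha+\beta}.$$ 2. $s/m\to0$ and $s/n\to0$ (for example, $s$ is constant), and $\frac{m}{m+n}\to\gamma$, $\frac{n}{m+n}\to\delta$. Then for all partitions $\lambda,\mu,\nu$, $$P_{m,n,s}(\lambda)\to\frac{e^{-(\gamma+\delta)}(\gamma+\delta)^{|\lambda|}}{h(\lambda)^2},\qquad Q_{m,n,s}(\mu,\nu)\to\frac{e^{-(\gamma+\delta)}\gamma^{|\mu|}\delta^{|\nu|}}{h(\mu)^2h(\nu)^2}.$$ Moreover $P_{m,n,s}$ is a probability measure that converges in distribution to the Poissonized Plancherel measure with parameter $\gamma+\delta$, and $Q_{m,n,s}$ is a finite measure that converges in distribution (i.e. the integrals of all bounded functions converge) to the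 law of a pair of independent Poissonized Plancherel partitions with parameters $\gamma$ and $\delta$. -/

import Mathlib

open Filter Topology

namespace RandomPartition

/-- The number of parts `l(μ)` of a partition (number of nonempty rows of its diagram). -/
def length (μ : YoungDiagram) : ℕ := μ.colLen 0

/-- The rectangular partition `(k^l)`: `l` parts, all equal to `k`. -/
def rect (k l : ℕ) : YoungDiagram where
  cells := Finset.range l ×ˢ Finset.range k
  isLowerSet := by
    rintro ⟨a, b⟩ ⟨c, d⟩ ⟨h₁, h₂⟩ h
    simp only [Finset.coe_product, Finset.coe_range, Set.mem_prod, Set.mem_Iio] at h ⊢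
    simp only at h₁ h₂
    omega

/-- The sum of partitions, `(μ + ν)_i = μ_i + ν_i`. -/
def add (μ ν : YoungDiagram) : YoungDiagram where
  cells := ((Finset.range (length μ + length ν)) ×ˢ
    (Finset.range (μ.rowLen 0 + ν.rowLen 0))).filter
      (fun c => c.2 < μ.rowLen c.1 + ν.rowLen c.1)
  isLowerSet := by
    rintro ⟨a, b⟩ ⟨c, d⟩ ⟨h₁, h₂⟩ h
    simp only [Finset.coe_filter, Finset.mem_product, Finset.mem_range, Set.mem_ofPred_eq] at h ⊢
    simp only at h₁ h₂
    have e₁ := μ.rowLen_anti _ _ h₁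
    have e₂ := ν.rowLen_anti _ _ h₁
    omega

/-- The union of partitions (the parts of `μ` together with those of `ν`), through the rule
`(μ ∪ ν)' = μ' + ν'`. If no part of `ν` exceeds a part of `μ`, it consists in appending `ν` to the
end of `μ`, see `rowLen_union`. -/
def union (μ ν : YoungDiagram) : YoungDiagram :=
  (add μ.transpose ν.transpose).transpose

theorem mem_add {μ ν : YoungDiagram} {i j : ℕ} :
    (i, j) ∈ add μ ν ↔ j < μ.rowLen i + ν.rowLen i := by
  rw [← YoungDiagram.mem_cells]
  simp only [add, Finset.mem_filter, Finset.mem_product, Finset.mem_range, length]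
  refine ⟨fun h => h.2, fun h => ⟨⟨?_, ?_⟩, h⟩⟩
  · by_contra hc
    have a₁ : ¬ (0 < μ.rowLen i) := by
      rw [← YoungDiagram.mem_iff_lt_rowLen, YoungDiagram.mem_iff_lt_colLen]; omega
    have a₂ : ¬ (0 < ν.rowLen i) := by
      rw [← YoungDiagram.mem_iff_lt_rowLen, YoungDiagram.mem_iff_lt_colLen]; omega
    omega
  · have e₁ := μ.rowLen_anti 0 i (Nat.zero_le _)
    have e₂ := ν.rowLen_anti 0 i (Nat.zero_le _)
    omega

theorem rowLen_add (μ ν : YoungDiagram) (i : ℕ) :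
    (add μ ν).rowLen i = μ.rowLen i + ν.rowLen i :=
  eq_of_forall_lt_iff fun j => by rw [← YoungDiagram.mem_iff_lt_rowLen, mem_add]

theorem rowLen_union (μ ν : YoungDiagram) (h : ∀ i < length μ, ν.rowLen 0 ≤ μ.rowLen i) (i : ℕ) :
    (union μ ν).rowLen i = if i < length μ then μ.rowLen i else ν.rowLen (i - length μ) := by
  refine eq_of_forall_lt_iff fun j => ?_
  rw [← YoungDiagram.mem_iff_lt_rowLen, union, YoungDiagram.mem_transpose, Prod.swap_prod_mk,
    mem_add, YoungDiagram.rowLen_transpose, YoungDiagram.rowLen_transpose]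
  have hμ : j < μ.rowLen i ↔ i < μ.colLen j := by
    rw [← YoungDiagram.mem_iff_lt_rowLen, YoungDiagram.mem_iff_lt_colLen]
  have hν : j < ν.rowLen (i - length μ) ↔ i - length μ < ν.colLen j := by
    rw [← YoungDiagram.mem_iff_lt_rowLen, YoungDiagram.mem_iff_lt_colLen]
  have hν0 : j < ν.rowLen 0 ↔ 0 < ν.colLen j := by
    rw [← YoungDiagram.mem_iff_lt_rowLen, YoungDiagram.mem_iff_lt_colLen]
  have hle : μ.colLen j ≤ length μ := μ.colLen_anti 0 j (Nat.zero_le _)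
  -- as soon as `ν` has a column `j`, column `j` of `μ` is full
  have hfull : 0 < ν.colLen j → μ.colLen j = length μ := by
    intro h0
    refine le_antisymm hle ?_
    by_contra hc
    have h1 := h (μ.colLen j) (by omega)
    have h2 : j < μ.rowLen (μ.colLen j) := lt_of_lt_of_le (hν0.2 h0) h1
    rw [← YoungDiagram.mem_iff_lt_rowLen, YoungDiagram.mem_iff_lt_colLen] at h2
    omega
  split_ifs with hi
  · rw [hμ]
    by_cases h0 : 0 < ν.colLen j
    · have := hfull h0; omega
    · omega
  · rw [hν]
    by_cases h0 : 0 < ν.colLen j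
    · have := hfull h0; omega
    · omega

/-- The hook length of the box `(i, j)` (0-indexed) of `μ`: one plus the number of boxes of `μ`
to its right in row `i` and below it in column `j`. -/
def hookLength (μ : YoungDiagram) (c : ℕ × ℕ) : ℕ :=
  1 + (μ.rowLen c.1 - (c.2 + 1)) + (μ.colLen c.2 - (c.1 + 1))

/-- `h(μ)`, the product of the hook lengths of all boxes. -/
def hookProd (μ : YoungDiagram) : ℕ := ∏ c ∈ μ.cells, hookLength μ c

noncomputable section

/-- `1 / (h(λ) h(λ + (s^{m+n})))` on partitions with at most `m + n` parts, zero on the others. -/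
def weight (m n s : ℕ) (lam : YoungDiagram) : ℝ :=
  if length lam ≤ m + n then
    1 / ((hookProd lam : ℝ) * hookProd (add lam (rect s (m + n))))
  else 0

/-- The normalization constant `Z_{m,n,s}`. -/
def Z (m n s : ℕ) : ℝ := ∑' lam : YoungDiagram, weight m n s lam

/-- The probabilities `P_{m,n,s}(λ)`. -/
def P (m n s : ℕ) (lam : YoungDiagram) : ℝ := weight m n s lam / Z m n s

/-- The probabilities `Q_{m,n,s}(μ, ν)`: for `l(μ) ≤ m` and `l(ν) ≤ n`,
`h((m^n)) / (Z h(μ) h(ν + (s^n)) h((μ + (s^m) + (n^m)) ∪ ν'))`, and zero otherwise. -/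
def Q (m n s : ℕ) (x : YoungDiagram × YoungDiagram) : ℝ :=
  if length x.1 ≤ m ∧ length x.2 ≤ n then
    (hookProd (rect m n) : ℝ) /
      (Z m n s * hookProd x.1 * hookProd (add x.2 (rect s n)) *
        hookProd (union (add (add x.1 (rect s m)) (rect n m)) x.2.transpose))
  else 0

/-- The Poissonized Plancherel measure with parameter `t`. -/
def poissonPlancherel (t : ℝ) (lam : YoungDiagram) : ℝ :=
  Real.exp (-t) * t ^ lam.card / (hookProd lam : ℝ) ^ 2

/-- Convergence in distribution on a discrete space, for measures given by their point masses:
the limit `q` is a probability distribution, and the integral of every bounded function converges.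
Summability is part of the definition, so that all the sums are genuine. -/
def ConvergesInDistribution {ι X : Type*} (l : Filter ι) (p : ι → X → ℝ) (q : X → ℝ) : Prop :=
  (∀ i, (∀ x, 0 ≤ p i x) ∧ Summable (p i)) ∧
  ((∀ x, 0 ≤ q x) ∧ HasSum q 1) ∧
  ∀ f : X → ℝ, (∃ C, ∀ x, |f x| ≤ C) →
    Tendsto (fun i => ∑' x, f x * p i x) l (𝓝 (∑' x, f x * q x))

end

end RandomPartition

/-! ### Hook products as Vandermonde quotients -/

namespace RandomPartition

open Finset

/-! Put l_i = λ_i + N - 1 - i, with N at least the number of parts. Then 1 / h(λ) = ∏_{i<j} (l_i -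
l_j) / ∏ l_i!. Adding the rectangle (s^N) shifts every l_i by s and leaves the Vandermonde product
alone, so 1 / h(λ + (s^N)) is 1 / h(λ) times a constant times a ratio of content products
(`inv_hookProd_add_rect`). Hence P is proportional to h(λ)^(-2) ∏ (m + n + c) / (m + n + s + c),
with c running over the contents of λ. In both regimes m / (m + n + s) → γ and n / (m + n + s) → δ,
so for fixed λ the product tends to (γ + δ)^|λ|.

For Q, the large diagram is an m × n rectangle with μ + (s^m) on its right and ν' below it, and only
the hooks inside the rectangle mix μ and ν (`hookProd_union`). Up to a fixed number of factors
tending to 1 (`interaction_eq`), their effect splits into a part for μ and a part for ν. Each part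
telescopes and turns the denominators m + s + c, respectively n + s + c, into m + n + s + c
(`contentRatio_mul_interaction`), whence γ^|μ| δ^|ν|. The constants collapse to the normalizer of P
(`Q_eq`).

Everything is dominated by inverse squared hook products, summable because ∑_{|μ|=n} h(μ)^(-2) = 1 /
n! (`sum_level_inv_hookProd_sq`). That identity double counts pairs of diagrams differing by one
box, through Lagrange interpolation at the l_i. The normalizer tends to e^(γ+δ) = e^γ e^δ, the mass
of both unnormalized limits, so the mass of Q itself is never computed. -/

theorem lt_rowLen_iff_lt_colLen {μ : YoungDiagram} {i j : ℕ} :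
    j < μ.rowLen i ↔ i < μ.colLen j := by
  rw [← YoungDiagram.mem_iff_lt_rowLen, YoungDiagram.mem_iff_lt_colLen]

theorem rowLen_eq_zero_iff {μ : YoungDiagram} {i : ℕ} : μ.rowLen i = 0 ↔ length μ ≤ i := by
  have := lt_rowLen_iff_lt_colLen (μ := μ) (i := i) (j := 0)
  unfold length
  omega

/-- Products over the boxes of a diagram, row by row. -/
theorem prod_cells {M : Type*} [CommMonoid M] {μ : YoungDiagram} {N : ℕ} (hN : length μ ≤ N)
    (f : ℕ → ℕ → M) :
    ∏ c ∈ μ.cells, f c.1 c.2 = ∏ i ∈ range N, ∏ j ∈ range (μ.rowLen i), f i j := by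
  rw [Finset.prod_sigma']
  refine Finset.prod_bij' (fun c _ => ⟨c.1, c.2⟩) (fun x _ => (x.1, x.2)) ?_ ?_ ?_ ?_ ?_
  · rintro ⟨i, j⟩ h
    rw [YoungDiagram.mem_cells, YoungDiagram.mem_iff_lt_rowLen] at h
    simp only [mem_sigma, mem_range]
    refine ⟨?_, h⟩
    by_contra hc
    have := rowLen_eq_zero_iff.2 (hN.trans (not_lt.1 hc))
    omega
  · rintro ⟨i, j⟩ h
    simp only [mem_sigma, mem_range] at h
    rw [YoungDiagram.mem_cells, YoungDiagram.mem_iff_lt_rowLen]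
    exact h.2
  · intros; rfl
  · intros; rfl
  · intros; rfl

theorem card_eq_sum_rowLen {μ : YoungDiagram} {N : ℕ} (hN : length μ ≤ N) :
    μ.card = ∑ i ∈ range N, μ.rowLen i := by
  have h := prod_cells (M := Multiplicative ℕ) hN (fun _ _ => Multiplicative.ofAdd 1)
  have h2 : ∑ c ∈ μ.cells, 1 = ∑ i ∈ range N, ∑ j ∈ range (μ.rowLen i), 1 := h
  simpa using h2

/-- The strictly decreasing sequence `λ_i + N - 1 - i` attached to a partition. -/
def shiftedRow (N : ℕ) (μ : YoungDiagram) (i : ℕ) : ℕ := μ.rowLen i + (N - 1 - i)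

theorem shiftedRow_lt {N : ℕ} (μ : YoungDiagram) {i k : ℕ} (hik : i < k) (hk : k < N) :
    shiftedRow N μ k < shiftedRow N μ i := by
  have := μ.rowLen_anti i k hik.le
  unfold shiftedRow
  omega

/-- The hook lengths in row `i`, together with the differences of `shiftedRow`, exhaust
`1, …, shiftedRow N μ i`. -/
theorem prod_hookLength_row {μ : YoungDiagram} {N : ℕ} (hN : length μ ≤ N) {i : ℕ} (hi : i < N) :
    (∏ j ∈ range (μ.rowLen i), hookLength μ (i, j)) *
      ∏ k ∈ Ioo i N, (shiftedRow N μ i - shiftedRow N μ k) = (shiftedRow N μ i).factorial := by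
  have hcol : ∀ j < μ.rowLen i, i < μ.colLen j := fun j hj => lt_rowLen_iff_lt_colLen.1 hj
  have hcolN : ∀ j, μ.colLen j ≤ N := fun j => (μ.colLen_anti 0 j (Nat.zero_le _)).trans hN
  have inj1 : Set.InjOn (fun j => hookLength μ (i, j)) (range (μ.rowLen i)) := by
    intro a ha b hb hab
    simp only [coe_range, Set.mem_Iio] at ha hb
    simp only [hookLength] at hab
    have h1 := hcol a ha
    have h2 := hcol b hb
    by_contra hne
    rcases Nat.lt_or_gt_of_ne hne with h | h
    · have := μ.colLen_anti a b h.le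
      omega
    · have := μ.colLen_anti b a h.le
      omega
  have inj2 : Set.InjOn (fun k => shiftedRow N μ i - shiftedRow N μ k) (Ioo i N) := by
    intro a ha b hb hab
    simp only [coe_Ioo, Set.mem_Ioo] at ha hb
    simp only at hab
    have h1 := shiftedRow_lt μ ha.1 ha.2
    have h2 := shiftedRow_lt μ hb.1 hb.2
    by_contra hne
    rcases Nat.lt_or_gt_of_ne hne with h | h
    · have := shiftedRow_lt μ h hb.2
      omega
    · have := shiftedRow_lt μ h ha.2
      omega
  -- A common value would give colLen j - k = j + 1 - rowLen k, impossible since k < colLen j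
  -- exactly when j < rowLen k.
  have disj : Disjoint ((range (μ.rowLen i)).image (fun j => hookLength μ (i, j)))
      ((Ioo i N).image (fun k => shiftedRow N μ i - shiftedRow N μ k)) := by
    rw [disjoint_left]
    intro x hx hy
    simp only [mem_image, mem_range, mem_Ioo] at hx hy
    obtain ⟨j, hj, rfl⟩ := hx
    obtain ⟨k, ⟨hk, hkN⟩, h⟩ := hy
    have h1 := hcol j hj
    have h3 := μ.rowLen_anti i k hk.le
    have h4 := lt_rowLen_iff_lt_colLen (μ := μ) (i := k) (j := j)
    simp only [hookLength, shiftedRow] at h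
    omega
  rw [← prod_range_add_one_eq_factorial, ← prod_image inj1 (f := fun x => x),
    ← prod_image inj2 (f := fun x => x), ← prod_union disj]
  have hset : ((range (μ.rowLen i)).image (fun j => hookLength μ (i, j))) ∪
      ((Ioo i N).image (fun k => shiftedRow N μ i - shiftedRow N μ k)) =
      Icc 1 (shiftedRow N μ i) := by
    -- The two images have sizes `μ.rowLen i` and N - 1 - i, which add up to `shiftedRow N μ i`.
    apply eq_of_subset_of_card_le
    · intro x hx
      simp only [mem_union, mem_image, mem_range, mem_Ioo] at hx
      rw [mem_Icc]
      rcases hx with ⟨j, hj, rfl⟩ | ⟨k, ⟨hk, hkN⟩, rfl⟩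
      · have h1 := hcol j hj
        have h2 := hcolN j
        simp only [hookLength, shiftedRow]
        omega
      · have := shiftedRow_lt μ hk hkN
        omega
    · rw [card_union_of_disjoint disj, card_image_of_injOn inj1, card_image_of_injOn inj2]
      simp only [Nat.card_Icc, card_range, Nat.card_Ioo, shiftedRow]
      omega
  rw [hset, Finset.range_eq_Ico, Finset.prod_Ico_add' (fun x => x) 0 (shiftedRow N μ i) 1]
  rfl

/-- The Vandermonde product `∏_{i < j < N} (x_i - x_j)`. -/
def vandermondeProd (N : ℕ) (x : ℕ → ℝ) : ℝ :=
  ∏ i ∈ range N, ∏ j ∈ range N, if i < j then x i - x j else 1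

theorem hookProd_mul_vandermondeProd {μ : YoungDiagram} {N : ℕ} (hN : length μ ≤ N) :
    (hookProd μ : ℝ) * vandermondeProd N (fun i => shiftedRow N μ i) =
      ∏ i ∈ range N, ((shiftedRow N μ i).factorial : ℝ) := by
  have h := prod_cells hN (fun i j => (hookLength μ (i, j) : ℝ))
  rw [hookProd, Nat.cast_prod, show (∏ c ∈ μ.cells, (hookLength μ c : ℝ)) = _ from h,
    vandermondeProd, ← prod_mul_distrib]
  refine prod_congr rfl fun i hi => ?_
  rw [mem_range] at hi
  rw [← prod_hookLength_row hN hi, Nat.cast_mul, Nat.cast_prod, Nat.cast_prod]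
  congr 1
  rw [← prod_filter]
  have : (range N).filter (fun j => i < j) = Ioo i N := by
    ext k; simp only [mem_filter, mem_range, mem_Ioo]; tauto
  rw [this]
  refine prod_congr rfl fun k hk => ?_
  rw [mem_Ioo] at hk
  rw [Nat.cast_sub (shiftedRow_lt μ hk.1 hk.2).le]

theorem hookProd_pos (μ : YoungDiagram) : (0 : ℝ) < hookProd μ := by
  unfold hookProd
  exact_mod_cast prod_pos fun c _ => by unfold hookLength; omega

theorem inv_hookProd {μ : YoungDiagram} {N : ℕ} (hN : length μ ≤ N) :
    (hookProd μ : ℝ)⁻¹ = vandermondeProd N (fun i => shiftedRow N μ i) /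
      ∏ i ∈ range N, ((shiftedRow N μ i).factorial : ℝ) := by
  have h0 := (hookProd_pos μ).ne'
  have h1 : ∏ i ∈ range N, ((shiftedRow N μ i).factorial : ℝ) ≠ 0 :=
    prod_ne_zero_iff.2 fun i _ => by positivity
  rw [eq_div_iff h1, ← hookProd_mul_vandermondeProd hN, inv_mul_cancel_left₀ h0]

/-- Isolating the factors of the Vandermonde product that contain `x_k`. -/
theorem vandermondeProd_eq {N k : ℕ} (hk : k < N) (x : ℕ → ℝ) :
    vandermondeProd N x =
      (∏ j ∈ (range N).erase k, (x k - x j)) *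
        ((∏ j ∈ (range N).erase k, if k < j then 1 else -1) *
        ∏ i ∈ (range N).erase k, ∏ j ∈ (range N).erase k, if i < j then x i - x j else 1) := by
  have hk' := mem_range.2 hk
  rw [vandermondeProd, ← mul_prod_erase _ _ hk', ← mul_prod_erase _ _ hk', if_neg (lt_irrefl k),
    one_mul, ← mul_assoc, ← prod_mul_distrib, ← prod_mul_distrib, ← prod_mul_distrib]
  refine prod_congr rfl fun j hj => ?_
  rw [← mul_prod_erase _ _ hk', ← mul_assoc]
  congr 1
  have : j ≠ k := (mem_erase.1 hj).1
  rcases Nat.lt_or_gt_of_ne this with h | h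
  · simp only [if_pos h, if_neg h.not_gt]; ring
  · simp only [if_pos h, if_neg (show ¬ j < k from h.not_gt), mul_one]

/-- Moving one point changes only the factors that involve it, and the signs cancel in the quotient.
This compares hook products before and after a one-box change. -/
theorem vandermondeProd_update {N k : ℕ} (hk : k < N) {x y : ℕ → ℝ}
    (hxy : ∀ j, j ≠ k → y j = x j) (hx : Set.InjOn x (range N)) :
    vandermondeProd N y = vandermondeProd N x *
      ∏ j ∈ (range N).erase k, (y k - x j) / (x k - x j) := by
  have hne : ∏ j ∈ (range N).erase k, (x k - x j) ≠ 0 := by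
    refine prod_ne_zero_iff.2 fun j hj => ?_
    rw [mem_erase] at hj
    exact sub_ne_zero.2 fun h => hj.1 (hx hj.2 (mem_range.2 hk) h.symm)
  have e1 : ∏ j ∈ (range N).erase k, (y k - y j) = ∏ j ∈ (range N).erase k, (y k - x j) :=
    prod_congr rfl fun j hj => by rw [hxy j (mem_erase.1 hj).1]
  have e2 : (∏ i ∈ (range N).erase k, ∏ j ∈ (range N).erase k, if i < j then y i - y j else 1) =
      ∏ i ∈ (range N).erase k, ∏ j ∈ (range N).erase k, if i < j then x i - x j else 1 :=
    prod_congr rfl fun i hi => prod_congr rfl fun j hj => by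
      rw [hxy j (mem_erase.1 hj).1, hxy i (mem_erase.1 hi).1]
  rw [vandermondeProd_eq hk y, vandermondeProd_eq hk x, e1, e2, prod_div_distrib]
  field_simp

end RandomPartition

/-! ### Two interpolation identities -/

namespace RandomPartition

open Finset Polynomial

/-- Comparison of `X e(X - 1)` and `(X - N) e(X)` for `e = ∏ (X - x_j)`, to second order. -/
theorem exists_shifted_nodal (x : ℕ → ℝ) (N : ℕ) :
    ∃ G : ℝ[X], G.degree < N ∧ G.coeff (N - 1) = (∑ j ∈ range N, (j : ℝ)) - ∑ j ∈ range N, x j ∧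
      X * ∏ j ∈ range N, (X - C (x j + 1)) =
        (X - C (N : ℝ)) * (∏ j ∈ range N, (X - C (x j))) + G := by
  induction N with
  | zero => exact ⟨0, by simp⟩
  | succ N ih =>
    obtain ⟨G, h1, h2, h3⟩ := ih
    have hmon : (∏ j ∈ range N, (X - C (x j))).Monic :=
      monic_prod_of_monic _ _ fun j _ => monic_X_sub_C _
    have hdeg : (∏ j ∈ range N, (X - C (x j))).natDegree = N := by
      rw [natDegree_finsetProd_X_sub_C_eq_card]; simp
    set e := ∏ j ∈ range N, (X - C (x j)) with he
    -- From (X - N)(X - x_N - 1) - (X - N - 1)(X - x_N) = N - x_N.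
    refine ⟨C ((N : ℝ) - x N) * e + (X - C (x N + 1)) * G, ?_, ?_, ?_⟩
    · refine (degree_add_le _ _).trans_lt (max_lt ?_ ?_)
      · rw [degree_mul]
        refine (add_le_add_left degree_C_le _).trans_lt ?_
        rw [zero_add, degree_eq_natDegree hmon.ne_zero, hdeg]
        exact_mod_cast Nat.lt_succ_self N
      · rw [degree_mul, degree_X_sub_C, add_comm, Nat.cast_add, Nat.cast_one]
        exact WithBot.add_lt_add_right (by simp) h1
    · rw [Nat.add_sub_cancel, coeff_add, coeff_C_mul, sub_mul X, coeff_sub, coeff_C_mul,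
        coeff_eq_zero_of_degree_lt h1, sum_range_succ, sum_range_succ]
      have hc : e.coeff N = 1 := by
        have := hmon.coeff_natDegree
        rwa [hdeg] at this
      have hX : (X * G).coeff N = G.coeff (N - 1) := by
        -- For N = 0 the index N - 1 truncates to 0, but the degree bound makes G vanish.
        cases N with
        | zero =>
          have : G = 0 := by
            rw [← degree_eq_bot]
            by_contra hb
            rw [degree_eq_natDegree (fun h => hb (by rw [h, degree_zero]))] at h1
            exact absurd h1 (by exact_mod_cast Nat.not_lt_zero _)
          simp [this]
        | succ M => rw [coeff_X_mul]; rfl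
      rw [hX, h2, hc]
      ring
    · rw [prod_range_succ, prod_range_succ, ← mul_assoc, h3, ← he]
      simp only [map_sub, map_add, Nat.cast_add, Nat.cast_one, map_one]
      ring

/-- At the node x_k the nodal product vanishes and the factor j = k of the shifted product is -1, so
the k-th summand is minus G(x_k) over the Lagrange denominator. Summing gives minus the coefficient
of G in degree N - 1. -/
theorem sum_mul_prod_sub_one_div {x : ℕ → ℝ} {N : ℕ} (hx : Set.InjOn x (range N)) :
    ∑ k ∈ range N, x k * ∏ j ∈ (range N).erase k, (x k - 1 - x j) / (x k - x j) =
      (∑ j ∈ range N, x j) - ∑ j ∈ range N, (j : ℝ) := by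
  obtain ⟨G, h1, h2, h3⟩ := exists_shifted_nodal x N
  have h4 := Lagrange.coeff_eq_sum hx (P := G) (by simpa using h1)
  rw [card_range, h2] at h4
  rw [← neg_sub, h4, ← sum_neg_distrib]
  refine sum_congr rfl fun k hk => ?_
  have h5 := congrArg (eval (x k)) h3
  simp only [eval_mul, eval_X, eval_add, eval_prod, eval_sub, eval_C] at h5
  rw [prod_eq_zero (f := fun j => x k - x j) hk (sub_self (x k)), mul_zero, zero_add,
    ← mul_prod_erase _ _ hk] at h5
  rw [← h5, prod_div_distrib]
  have : ∏ j ∈ (range N).erase k, (x k - (x j + 1)) = ∏ j ∈ (range N).erase k, (x k - 1 - x j) :=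
    prod_congr rfl fun j _ => by ring
  rw [this]
  ring

/-- Since x_N = 0, the factor x_k + 1 - x_N cancels the inverse. What remains is the leading
coefficient of a monic polynomial of degree N, read off at N + 1 nodes. -/
theorem sum_prod_add_one_div {x : ℕ → ℝ} {N : ℕ} (hx : Set.InjOn x (range (N + 1)))
    (hpos : ∀ j, 0 ≤ x j) (h0 : x N = 0) :
    ∑ k ∈ range (N + 1),
      (x k + 1)⁻¹ * ∏ j ∈ (range (N + 1)).erase k, (x k + 1 - x j) / (x k - x j) = 1 := by
  have hmon : (∏ j ∈ range N, (X - C (x j - 1))).Monic :=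
    monic_prod_of_monic _ _ fun j _ => monic_X_sub_C _
  have hdeg : (∏ j ∈ range N, (X - C (x j - 1))).degree = (N : WithBot ℕ) := by
    rw [degree_eq_natDegree hmon.ne_zero, natDegree_finsetProd_X_sub_C_eq_card]; simp
  have h := Lagrange.leadingCoeff_eq_sum hx (P := ∏ j ∈ range N, (X - C (x j - 1)))
    (by rw [hdeg]; simp)
  rw [hmon.leadingCoeff] at h
  refine Eq.trans ?_ h.symm
  refine sum_congr rfl fun k hk => ?_
  have hk1 : x k + 1 ≠ 0 := by have := hpos k; positivity
  have e : (x k + 1) * ∏ j ∈ range N, (x k - (x j - 1)) =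
      ∏ j ∈ (range (N + 1)).erase k, (x k + 1 - x j) := by
    have h1 := mul_prod_erase (range (N + 1)) (fun j => x k + 1 - x j) hk
    rw [prod_range_succ, h0] at h1
    simp only [add_sub_cancel_left, one_mul, sub_zero] at h1
    rw [h1, mul_comm]
    congr 1
    exact prod_congr rfl fun j _ => by ring
  rw [prod_div_distrib, ← e, eval_prod]
  simp only [eval_sub, eval_X, eval_C]
  field_simp

/-! ### Adding and removing boxes -/

/-- A box can be added at the end of row `i`. -/
def Addable (μ : YoungDiagram) (i : ℕ) : Prop := ∀ k < i, μ.rowLen i < μ.rowLen k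

/-- The last box of row `i` can be removed. -/
def Removable (μ : YoungDiagram) (i : ℕ) : Prop := μ.rowLen (i + 1) < μ.rowLen i

open Classical in
/-- Adds a box at the end of row `i` if possible. -/
noncomputable def addBox (μ : YoungDiagram) (i : ℕ) : YoungDiagram :=
  if h : Addable μ i then
    { cells := insert (i, μ.rowLen i) μ.cells
      isLowerSet := by
        rintro ⟨a, b⟩ ⟨c, d⟩ ⟨h₁, h₂⟩ hab
        simp only [coe_insert, Set.mem_insert_iff, mem_coe, YoungDiagram.mem_cells,
          YoungDiagram.mem_iff_lt_rowLen, Prod.mk.injEq] at hab h₁ h₂ ⊢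
        rcases hab with ⟨rfl, rfl⟩ | hab
        · rcases Nat.lt_or_eq_of_le h₁ with h' | rfl
          · have := h c h'
            omega
          · omega
        · have := μ.rowLen_anti c a h₁
          omega }
  else μ

open Classical in
/-- Removes the last box of row `i` if possible. -/
noncomputable def removeBox (μ : YoungDiagram) (i : ℕ) : YoungDiagram :=
  if h : Removable μ i then
    { cells := μ.cells.erase (i, μ.rowLen i - 1)
      isLowerSet := by
        rintro ⟨a, b⟩ ⟨c, d⟩ ⟨h₁, h₂⟩ hab
        simp only [coe_erase, Set.mem_sdiff, mem_coe, YoungDiagram.mem_cells,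
          YoungDiagram.mem_iff_lt_rowLen, Set.mem_singleton_iff, Prod.mk.injEq] at hab h₁ h₂ ⊢
        have h3 := μ.rowLen_anti c a h₁
        unfold Removable at h
        refine ⟨by omega, ?_⟩
        rintro ⟨rfl, rfl⟩
        rcases Nat.lt_or_eq_of_le h₁ with h' | rfl
        · have := μ.rowLen_anti (c + 1) a h'
          omega
        · omega }
  else μ

theorem cells_addBox {μ : YoungDiagram} {i : ℕ} (h : Addable μ i) :
    (addBox μ i).cells = insert (i, μ.rowLen i) μ.cells := by
  rw [addBox, dif_pos h]

theorem cells_removeBox {μ : YoungDiagram} {i : ℕ} (h : Removable μ i) :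
    (removeBox μ i).cells = μ.cells.erase (i, μ.rowLen i - 1) := by
  rw [removeBox, dif_pos h]

theorem rowLen_addBox {μ : YoungDiagram} {i : ℕ} (h : Addable μ i) (k : ℕ) :
    (addBox μ i).rowLen k = if k = i then μ.rowLen i + 1 else μ.rowLen k := by
  refine eq_of_forall_lt_iff fun j => ?_
  rw [← YoungDiagram.mem_iff_lt_rowLen, ← YoungDiagram.mem_cells, cells_addBox h, mem_insert,
    YoungDiagram.mem_cells, YoungDiagram.mem_iff_lt_rowLen, Prod.mk.injEq]
  split_ifs with hk
  · subst hk; omega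
  · simp [hk]

theorem rowLen_removeBox {μ : YoungDiagram} {i : ℕ} (h : Removable μ i) (k : ℕ) :
    (removeBox μ i).rowLen k = if k = i then μ.rowLen i - 1 else μ.rowLen k := by
  refine eq_of_forall_lt_iff fun j => ?_
  rw [← YoungDiagram.mem_iff_lt_rowLen, ← YoungDiagram.mem_cells, cells_removeBox h, mem_erase,
    YoungDiagram.mem_cells, YoungDiagram.mem_iff_lt_rowLen, Ne, Prod.mk.injEq]
  split_ifs with hk
  · subst hk; omega
  · simp [hk]

theorem ext_rowLen {μ ν : YoungDiagram} (h : ∀ i, μ.rowLen i = ν.rowLen i) : μ = ν := by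
  ext ⟨i, j⟩
  rw [YoungDiagram.mem_cells, YoungDiagram.mem_cells, YoungDiagram.mem_iff_lt_rowLen,
    YoungDiagram.mem_iff_lt_rowLen, h]

theorem card_addBox {μ : YoungDiagram} {i : ℕ} (h : Addable μ i) :
    (addBox μ i).card = μ.card + 1 := by
  rw [YoungDiagram.card, cells_addBox h, card_insert_of_notMem]
  rw [YoungDiagram.mem_cells, YoungDiagram.mem_iff_lt_rowLen]
  omega

theorem card_removeBox {μ : YoungDiagram} {i : ℕ} (h : Removable μ i) :
    (removeBox μ i).card + 1 = μ.card := by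
  rw [YoungDiagram.card, cells_removeBox h, card_erase_add_one]
  unfold Removable at h
  rw [YoungDiagram.mem_cells, YoungDiagram.mem_iff_lt_rowLen]
  omega

theorem removable_addBox {μ : YoungDiagram} {i : ℕ} (h : Addable μ i) :
    Removable (addBox μ i) i := by
  have := μ.rowLen_anti i (i + 1) (Nat.le_succ i)
  rw [Removable, rowLen_addBox h, rowLen_addBox h, if_pos rfl, if_neg (by omega)]
  omega

theorem addable_removeBox {μ : YoungDiagram} {i : ℕ} (h : Removable μ i) :
    Addable (removeBox μ i) i := by
  intro k hk
  have := μ.rowLen_anti k i hk.le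
  rw [rowLen_removeBox h, rowLen_removeBox h, if_pos rfl, if_neg (by omega)]
  unfold Removable at h
  omega

theorem removeBox_addBox {μ : YoungDiagram} {i : ℕ} (h : Addable μ i) :
    removeBox (addBox μ i) i = μ := by
  refine ext_rowLen fun k => ?_
  rw [rowLen_removeBox (removable_addBox h), rowLen_addBox h, rowLen_addBox h, if_pos rfl]
  split_ifs with hk
  · rw [hk]; rfl
  · rfl

theorem addBox_removeBox {μ : YoungDiagram} {i : ℕ} (h : Removable μ i) :
    addBox (removeBox μ i) i = μ := by
  refine ext_rowLen fun k => ?_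
  rw [rowLen_addBox (addable_removeBox h), rowLen_removeBox h, rowLen_removeBox h, if_pos rfl]
  unfold Removable at h
  split_ifs with hk
  · subst hk; omega
  · rfl

theorem length_le_card (μ : YoungDiagram) : length μ ≤ μ.card := by
  rw [length, YoungDiagram.colLen_eq_card]
  exact card_le_card (filter_subset _ _)

theorem length_le_iff {μ : YoungDiagram} {N : ℕ} : length μ ≤ N ↔ μ.rowLen N = 0 :=
  rowLen_eq_zero_iff.symm

theorem shiftedRow_injOn (N : ℕ) (μ : YoungDiagram) :
    Set.InjOn (fun i => (shiftedRow N μ i : ℝ)) (range N) := by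
  intro a ha b hb hab
  simp only [coe_range, Set.mem_Iio] at ha hb
  simp only [Nat.cast_inj] at hab
  by_contra hne
  rcases Nat.lt_or_gt_of_ne hne with h | h
  · have := shiftedRow_lt μ h hb
    omega
  · have := shiftedRow_lt μ h ha
    omega

theorem inv_hookProd_addBox {μ : YoungDiagram} {N i : ℕ} (hN : length μ ≤ N) (hi : i < N)
    (h : Addable μ i) :
    (hookProd (addBox μ i) : ℝ)⁻¹ = (hookProd μ : ℝ)⁻¹ * ((shiftedRow N μ i + 1 : ℝ)⁻¹ *
      ∏ j ∈ (range N).erase i, ((shiftedRow N μ i : ℝ) + 1 - shiftedRow N μ j) /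
        ((shiftedRow N μ i : ℝ) - shiftedRow N μ j)) := by
  have hN' : length (addBox μ i) ≤ N := by
    rw [length_le_iff, rowLen_addBox h, if_neg (by omega)]
    exact length_le_iff.1 hN
  have hs : ∀ j, j ≠ i → shiftedRow N (addBox μ i) j = shiftedRow N μ j := fun j hj => by
    rw [shiftedRow, rowLen_addBox h, if_neg hj, shiftedRow]
  have hsi : shiftedRow N (addBox μ i) i = shiftedRow N μ i + 1 := by
    rw [shiftedRow, rowLen_addBox h, if_pos rfl, shiftedRow]; omega
  have hi' := mem_range.2 hi
  rw [inv_hookProd hN', inv_hookProd hN,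
    vandermondeProd_update hi (fun j hj => by rw [hs j hj]) (shiftedRow_injOn N μ),
    ← mul_prod_erase (range N) (fun k => ((shiftedRow N μ k).factorial : ℝ)) hi',
    ← mul_prod_erase (range N) (fun k => ((shiftedRow N (addBox μ i) k).factorial : ℝ)) hi',
    prod_congr rfl (fun j hj => by rw [hs j (mem_erase.1 hj).1] :
      ∀ j ∈ (range N).erase i, ((shiftedRow N (addBox μ i) j).factorial : ℝ) =
        (shiftedRow N μ j).factorial), hsi, Nat.factorial_succ]
  have : ∏ k ∈ (range N).erase i, ((shiftedRow N μ k).factorial : ℝ) ≠ 0 :=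
    prod_ne_zero_iff.2 fun i _ => by positivity
  push_cast
  field_simp

theorem inv_hookProd_removeBox {μ : YoungDiagram} {N i : ℕ} (hN : length μ ≤ N) (hi : i < N)
    (h : Removable μ i) :
    (hookProd (removeBox μ i) : ℝ)⁻¹ = (hookProd μ : ℝ)⁻¹ * ((shiftedRow N μ i : ℝ) *
      ∏ j ∈ (range N).erase i, ((shiftedRow N μ i : ℝ) - 1 - shiftedRow N μ j) /
        ((shiftedRow N μ i : ℝ) - shiftedRow N μ j)) := by
  have hN' : length (removeBox μ i) ≤ N := by
    rw [length_le_iff, rowLen_removeBox h, if_neg (by omega)]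
    exact length_le_iff.1 hN
  have hs : ∀ j, j ≠ i → shiftedRow N (removeBox μ i) j = shiftedRow N μ j := fun j hj => by
    rw [shiftedRow, rowLen_removeBox h, if_neg hj, shiftedRow]
  have hsi : shiftedRow N μ i = shiftedRow N (removeBox μ i) i + 1 := by
    unfold Removable at h
    rw [shiftedRow, shiftedRow, rowLen_removeBox h, if_pos rfl]; omega
  have hsi' : (shiftedRow N (removeBox μ i) i : ℝ) = (shiftedRow N μ i : ℝ) - 1 := by
    rw [hsi]; push_cast; ring
  have hi' := mem_range.2 hi
  have hf : ((shiftedRow N μ i).factorial : ℝ) =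
      shiftedRow N μ i * (shiftedRow N (removeBox μ i) i).factorial := by
    rw [hsi, Nat.factorial_succ]; push_cast; rfl
  have h0 : (shiftedRow N μ i : ℝ) ≠ 0 := by rw [hsi]; positivity
  rw [inv_hookProd hN', inv_hookProd hN,
    vandermondeProd_update hi (fun j hj => by rw [hs j hj]) (shiftedRow_injOn N μ),
    ← mul_prod_erase (range N) (fun k => ((shiftedRow N μ k).factorial : ℝ)) hi',
    ← mul_prod_erase (range N) (fun k => ((shiftedRow N (removeBox μ i) k).factorial : ℝ)) hi',
    prod_congr rfl (fun j hj => by rw [hs j (mem_erase.1 hj).1] :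
      ∀ j ∈ (range N).erase i, ((shiftedRow N (removeBox μ i) j).factorial : ℝ) =
        (shiftedRow N μ j).factorial), hsi', hf]
  have : ∏ k ∈ (range N).erase i, ((shiftedRow N μ k).factorial : ℝ) ≠ 0 :=
    prod_ne_zero_iff.2 fun i _ => by positivity
  field_simp

-- The interpolation identity at N + 1 nodes: the extra row N is where a new part may open, and its
-- node is 0. Rows that are not addable contribute zero.
open Classical in
theorem sum_inv_hookProd_addBox {μ : YoungDiagram} {N : ℕ} (hN : length μ ≤ N) :
    ∑ i ∈ range (N + 1) with Addable μ i, (hookProd (addBox μ i) : ℝ)⁻¹ =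
      (hookProd μ : ℝ)⁻¹ := by
  have h0 : (shiftedRow (N + 1) μ N : ℝ) = 0 := by
    rw [shiftedRow, length_le_iff.1 hN]; simp
  have key := sum_prod_add_one_div (shiftedRow_injOn (N + 1) μ) (fun j => by positivity) h0
  rw [sum_filter, ← mul_one (hookProd μ : ℝ)⁻¹, ← key, mul_sum]
  refine sum_congr rfl fun i hi => ?_
  rw [mem_range] at hi
  split_ifs with h
  · exact inv_hookProd_addBox (hN.trans (Nat.le_succ N)) hi h
  -- Rows i - 1 and i are equal, so their nodes differ by exactly 1 and a numerator vanishes.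
  · unfold Addable at h
    push Not at h
    obtain ⟨k, hk, hle⟩ := h
    have h1 := μ.rowLen_anti k (i - 1) (by omega)
    have h2 := μ.rowLen_anti (i - 1) i (by omega)
    have h3 : shiftedRow (N + 1) μ (i - 1) = shiftedRow (N + 1) μ i + 1 := by
      unfold shiftedRow; omega
    rw [prod_eq_zero (i := i - 1), mul_zero, mul_zero]
    · rw [mem_erase, mem_range]; omega
    · rw [h3]; push_cast; simp

open Classical in
theorem sum_inv_hookProd_removeBox {μ : YoungDiagram} {N : ℕ} (hN : length μ ≤ N) :
    ∑ i ∈ range N with Removable μ i, (hookProd (removeBox μ i) : ℝ)⁻¹ =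
      μ.card * (hookProd μ : ℝ)⁻¹ := by
  have key := sum_mul_prod_sub_one_div (shiftedRow_injOn N μ)
  have hsum : (∑ j ∈ range N, (shiftedRow N μ j : ℝ)) - ∑ j ∈ range N, (j : ℝ) = μ.card := by
    have : ∑ j ∈ range N, ((N - 1 - j : ℕ) : ℝ) = ∑ j ∈ range N, (j : ℝ) :=
      sum_range_reflect (fun j => (j : ℝ)) N
    rw [card_eq_sum_rowLen hN, ← this, ← sum_sub_distrib, Nat.cast_sum]
    exact sum_congr rfl fun j _ => by unfold shiftedRow; push_cast; ring
  rw [sum_filter, mul_comm, ← hsum, ← key, mul_sum]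
  refine sum_congr rfl fun i hi => ?_
  rw [mem_range] at hi
  split_ifs with h
  · exact inv_hookProd_removeBox hN hi h
  -- Either row i + 1 equals row i and a numerator vanishes, or i is the last index, its row is
  -- empty and the node itself is 0.
  · unfold Removable at h
    have h2 := μ.rowLen_anti i (i + 1) (by omega)
    by_cases hiN : i + 1 < N
    · have h3 : shiftedRow N μ i = shiftedRow N μ (i + 1) + 1 := by
        unfold shiftedRow; omega
      rw [prod_eq_zero (i := i + 1), mul_zero, mul_zero]
      · rw [mem_erase, mem_range]; omega
      · rw [h3]; push_cast; simp
    · have h3 : μ.rowLen (i + 1) = 0 := by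
        rw [← length_le_iff]; omega
      have h4 : shiftedRow N μ i = 0 := by
        unfold shiftedRow; omega
      rw [h4, Nat.cast_zero, zero_mul, mul_zero]

/-! ### Sums of inverse squared hook products -/

theorem finite_card_eq (n : ℕ) : {μ : YoungDiagram | μ.card = n}.Finite := by
  have hinj : Function.Injective YoungDiagram.cells := fun μ ν h => by
    ext c; rw [h]
  refine ((range n ×ˢ range n).powerset.finite_toSet.preimage hinj.injOn).subset ?_
  intro μ hμ
  rw [Set.mem_ofPred_eq] at hμ
  simp only [coe_powerset, Set.mem_preimage, Set.mem_powerset_iff, coe_subset]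
  rintro ⟨i, j⟩ hc
  rw [YoungDiagram.mem_cells] at hc
  have h1 := length_le_card μ
  have h2 : μ.rowLen 0 ≤ μ.card := by
    rw [YoungDiagram.rowLen_eq_card]
    exact card_le_card (filter_subset _ _)
  have h3 := YoungDiagram.mem_iff_lt_rowLen.1 hc
  have h4 := YoungDiagram.mem_iff_lt_colLen.1 hc
  have h5 := μ.rowLen_anti 0 i (Nat.zero_le _)
  have h6 := μ.colLen_anti 0 j (Nat.zero_le _)
  unfold length at h1
  rw [mem_product, mem_range, mem_range]
  simp only
  omega

/-- The partitions of `n`. -/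
noncomputable def level (n : ℕ) : Finset YoungDiagram := (finite_card_eq n).toFinset

theorem mem_level {n : ℕ} {μ : YoungDiagram} : μ ∈ level n ↔ μ.card = n := by
  simp [level]

-- Both sides sum 1 / (h(μ) h(ν)) over pairs where μ has n + 1 boxes and ν is μ with one box
-- removed, grouped by μ on the left and by ν on the right.
open Classical in
theorem succ_mul_sum_level (n : ℕ) :
    (n + 1 : ℝ) * ∑ μ ∈ level (n + 1), ((hookProd μ : ℝ) ^ 2)⁻¹ =
      ∑ μ ∈ level n, ((hookProd μ : ℝ) ^ 2)⁻¹ := by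
  have hL : (n + 1 : ℝ) * ∑ μ ∈ level (n + 1), ((hookProd μ : ℝ) ^ 2)⁻¹ =
      ∑ μ ∈ level (n + 1), ∑ i ∈ range (n + 1) with Removable μ i,
        (hookProd μ : ℝ)⁻¹ * (hookProd (removeBox μ i) : ℝ)⁻¹ := by
    rw [mul_sum]
    refine sum_congr rfl fun μ hμ => ?_
    rw [mem_level] at hμ
    rw [← mul_sum, sum_inv_hookProd_removeBox ((length_le_card μ).trans hμ.le), hμ]
    push_cast
    ring
  have hR : ∑ μ ∈ level n, ((hookProd μ : ℝ) ^ 2)⁻¹ =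
      ∑ μ ∈ level n, ∑ i ∈ range (n + 1) with Addable μ i,
        (hookProd μ : ℝ)⁻¹ * (hookProd (addBox μ i) : ℝ)⁻¹ := by
    refine sum_congr rfl fun μ hμ => ?_
    rw [mem_level] at hμ
    rw [← mul_sum, sum_inv_hookProd_addBox ((length_le_card μ).trans hμ.le)]
    ring
  rw [hL, hR, sum_sigma', sum_sigma']
  refine sum_bij' (fun x _ => ⟨removeBox x.1 x.2, x.2⟩) (fun x _ => ⟨addBox x.1 x.2, x.2⟩)
    ?_ ?_ ?_ ?_ ?_
  · rintro ⟨μ, i⟩ h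
    simp only [mem_sigma, mem_filter, mem_level] at h ⊢
    have := card_removeBox h.2.2
    exact ⟨by omega, h.2.1, addable_removeBox h.2.2⟩
  · rintro ⟨μ, i⟩ h
    simp only [mem_sigma, mem_filter, mem_level] at h ⊢
    have := card_addBox h.2.2
    exact ⟨by omega, h.2.1, removable_addBox h.2.2⟩
  · rintro ⟨μ, i⟩ h
    simp only [mem_sigma, mem_filter] at h
    simp only [addBox_removeBox h.2.2]
  · rintro ⟨μ, i⟩ h
    simp only [mem_sigma, mem_filter] at h
    simp only [removeBox_addBox h.2.2]
  · rintro ⟨μ, i⟩ h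
    simp only [mem_sigma, mem_filter] at h
    simp only [addBox_removeBox h.2.2]
    ring

/-- `∑_{|μ| = n} 1 / h(μ)² = 1 / n!`. -/
theorem sum_level_inv_hookProd_sq (n : ℕ) :
    ∑ μ ∈ level n, ((hookProd μ : ℝ) ^ 2)⁻¹ = (n.factorial : ℝ)⁻¹ := by
  induction n with
  | zero =>
    have : level 0 = {⊥} := by
      ext μ
      rw [mem_level, mem_singleton, YoungDiagram.card, card_eq_zero]
      constructor
      · intro h; ext c; rw [h]; rfl
      · rintro rfl; rfl
    rw [this, sum_singleton]
    simp [hookProd]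
  | succ n ih =>
    rw [Nat.factorial_succ, Nat.cast_mul, mul_inv, ← ih, ← succ_mul_sum_level n, Nat.cast_succ,
      inv_mul_cancel_left₀ (by positivity)]

theorem hasSum_pow_card_div {t : ℝ} (ht : 0 ≤ t) :
    HasSum (fun μ : YoungDiagram => t ^ μ.card / (hookProd μ : ℝ) ^ 2) (Real.exp t) := by
  rw [← (Equiv.sigmaFiberEquiv YoungDiagram.card).hasSum_iff]
  have hfib : ∀ n, HasSum (fun μ : {μ : YoungDiagram // μ.card = n} =>
      t ^ μ.1.card / (hookProd μ.1 : ℝ) ^ 2) (t ^ n / n.factorial) := by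
    intro n
    have h := (level n).hasSum (fun μ => t ^ μ.card / (hookProd μ : ℝ) ^ 2)
    have e : ∑ μ ∈ level n, t ^ μ.card / (hookProd μ : ℝ) ^ 2 = t ^ n / n.factorial := by
      rw [div_eq_mul_inv, ← sum_level_inv_hookProd_sq, mul_sum]
      exact sum_congr rfl fun μ hμ => by rw [mem_level.1 hμ, div_eq_mul_inv]
    rw [e] at h
    exact (Equiv.subtypeEquivRight (fun μ => mem_level (n := n) (μ := μ))).symm.hasSum_iff.2 h
  have hexp : HasSum (fun n : ℕ => t ^ n / n.factorial) (Real.exp t) := by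
    rw [Real.exp_eq_exp_ℝ]
    exact NormedSpace.expSeries_div_hasSum_exp t
  have hsum : Summable ((fun μ : YoungDiagram => t ^ μ.card / (hookProd μ : ℝ) ^ 2) ∘
      (Equiv.sigmaFiberEquiv YoungDiagram.card)) := by
    refine (summable_sigma_of_nonneg fun x => by
      simp only [Function.comp]; positivity).2 ⟨fun n => (hfib n).summable, ?_⟩
    refine hexp.summable.congr fun n => ?_
    exact (hfib n).tsum_eq.symm
  have := hsum.hasSum.sigma hfib
  rw [← this.unique hexp]
  exact hsum.hasSum

/-! ### Rectangles and content products -/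

theorem rowLen_rect (k l i : ℕ) : (rect k l).rowLen i = if i < l then k else 0 := by
  refine eq_of_forall_lt_iff fun j => ?_
  rw [← YoungDiagram.mem_iff_lt_rowLen, ← YoungDiagram.mem_cells]
  simp only [rect, mem_product, mem_range]
  split_ifs with h <;> simp [h]

theorem rowLen_bot (i : ℕ) : (⊥ : YoungDiagram).rowLen i = 0 := by
  by_contra h
  exact YoungDiagram.notMem_bot (i, 0) (YoungDiagram.mem_iff_lt_rowLen.2 (Nat.pos_of_ne_zero h))

theorem bot_add (μ : YoungDiagram) : add ⊥ μ = μ :=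
  ext_rowLen fun i => by rw [rowLen_add, rowLen_bot, zero_add]

theorem length_add_rect_le {μ : YoungDiagram} {N : ℕ} (hN : length μ ≤ N) (s : ℕ) :
    length (add μ (rect s N)) ≤ N := by
  rw [length_le_iff, rowLen_add, rowLen_rect, length_le_iff.1 hN]
  simp

/-- `∏_{(i, j) ∈ μ} (u - i + j) / (v - i + j)`, a ratio of content products. -/
noncomputable def contentRatio (u v : ℕ) (μ : YoungDiagram) : ℝ :=
  ∏ c ∈ μ.cells, ((u : ℝ) - c.1 + c.2) / ((v : ℝ) - c.1 + c.2)

/-- The weight of the empty partition, `∏_{a < N} a! / (a + s)!`. -/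
noncomputable def baseWeight (N s : ℕ) : ℝ :=
  ∏ a ∈ range N, (a.factorial : ℝ) / ((a + s).factorial : ℝ)

theorem baseWeight_pos (N s : ℕ) : 0 < baseWeight N s :=
  prod_pos fun _ _ => by positivity

theorem contentRatio_bot (u v : ℕ) : contentRatio u v ⊥ = 1 := by
  simp [contentRatio]

theorem contentRatio_eq {μ : YoungDiagram} {N : ℕ} (hN : length μ ≤ N) (u v : ℕ) :
    contentRatio u v μ =
      ∏ i ∈ range N, ∏ j ∈ range (μ.rowLen i), ((u : ℝ) - i + j) / ((v : ℝ) - i + j) :=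
  prod_cells hN (fun i j : ℕ => ((u : ℝ) - i + j) / ((v : ℝ) - i + j))

theorem fst_lt_length {μ : YoungDiagram} {c : ℕ × ℕ} (hc : c ∈ μ.cells) : c.1 < length μ := by
  rw [YoungDiagram.mem_cells] at hc
  have h := YoungDiagram.mem_iff_lt_colLen.1 (show (c.1, c.2) ∈ μ from hc)
  exact h.trans_le (μ.colLen_anti 0 c.2 (Nat.zero_le _))

theorem contentRatio_nonneg {μ : YoungDiagram} {u v : ℕ} (hu : length μ ≤ u) (huv : u ≤ v) :
    0 ≤ contentRatio u v μ := by
  refine prod_nonneg fun c hc => ?_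
  have h : ((c.1 : ℕ) : ℝ) ≤ u := by exact_mod_cast ((fst_lt_length hc).trans_le hu).le
  have h2 : (u : ℝ) ≤ v := by exact_mod_cast huv
  have h3 : (0 : ℝ) ≤ c.2 := by positivity
  exact div_nonneg (by linarith) (by linarith)

/-- The bound on the length keeps every u - i + j nonnegative. Domination rests on this estimate. -/
theorem contentRatio_le_one {μ : YoungDiagram} {u v : ℕ} (hu : length μ ≤ u) (huv : u ≤ v) :
    contentRatio u v μ ≤ 1 := by
  refine prod_le_one (fun c hc => ?_) (fun c hc => ?_)
  all_goals
    have h : ((c.1 : ℕ) : ℝ) ≤ u := by exact_mod_cast ((fst_lt_length hc).trans_le hu).le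
    have h2 : (u : ℝ) ≤ v := by exact_mod_cast huv
    have h3 : (0 : ℝ) ≤ c.2 := by positivity
  · exact div_nonneg (by linarith) (by linarith)
  · exact div_le_one_of_le₀ (by linarith) (by linarith)

theorem factorial_add_eq_prod (k p : ℕ) :
    ((k + p).factorial : ℝ) = k.factorial * ∏ j ∈ range p, ((k : ℝ) + 1 + j) := by
  induction p with
  | zero => simp
  | succ p ih =>
    rw [prod_range_succ, ← mul_assoc, ← ih, ← add_assoc, Nat.factorial_succ]
    push_cast
    ring

theorem prod_factorial_shiftedRow {μ : YoungDiagram} {N : ℕ} (hN : length μ ≤ N) (s : ℕ) :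
    ∏ i ∈ range N, ((shiftedRow N μ i).factorial : ℝ) / ((shiftedRow N μ i + s).factorial : ℝ) =
      baseWeight N s * contentRatio N (N + s) μ := by
  -- Row i is matched with a = N - 1 - i; its boxes supply the consecutive integers by which (a +
  -- λ_i)! exceeds a!.
  rw [baseWeight, ← prod_range_reflect (fun a => (a.factorial : ℝ) / ((a + s).factorial : ℝ)),
    contentRatio_eq hN, ← prod_mul_distrib]
  refine prod_congr rfl fun i hi => ?_
  rw [mem_range] at hi
  rw [prod_div_distrib, shiftedRow, add_comm (μ.rowLen i), factorial_add_eq_prod,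
    add_right_comm, factorial_add_eq_prod]
  have e1 : ∀ j : ℕ, ((N - 1 - i : ℕ) : ℝ) + 1 + j = (N : ℝ) - i + j := fun j => by
    rw [Nat.sub_sub, Nat.cast_sub (by omega)]; push_cast; ring
  have e2 : ∀ j : ℕ, ((N - 1 - i + s : ℕ) : ℝ) + 1 + j = ((N + s : ℕ) : ℝ) - i + j := fun j => by
    rw [Nat.cast_add, Nat.sub_sub, Nat.cast_sub (by omega)]; push_cast; ring
  simp only [e1, e2]
  rw [mul_div_mul_comm]

/-- All shifted rows move by s, so their differences persist and only the factorials change. -/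
theorem inv_hookProd_add_rect {μ : YoungDiagram} {N : ℕ} (hN : length μ ≤ N) (s : ℕ) :
    (hookProd (add μ (rect s N)) : ℝ)⁻¹ =
      (hookProd μ : ℝ)⁻¹ * (baseWeight N s * contentRatio N (N + s) μ) := by
  have hs : ∀ i ∈ range N, shiftedRow N (add μ (rect s N)) i = shiftedRow N μ i + s := by
    intro i hi
    rw [mem_range] at hi
    rw [shiftedRow, shiftedRow, rowLen_add, rowLen_rect, if_pos hi]
    omega
  have hv : vandermondeProd N (fun i => (shiftedRow N (add μ (rect s N)) i : ℝ)) =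
      vandermondeProd N (fun i => (shiftedRow N μ i : ℝ)) := by
    refine prod_congr rfl fun i hi => prod_congr rfl fun j hj => ?_
    simp only [hs i hi, hs j hj, Nat.cast_add]
    rw [add_sub_add_right_eq_sub]
  have hf : ∏ i ∈ range N, ((shiftedRow N (add μ (rect s N)) i).factorial : ℝ) =
      ∏ i ∈ range N, ((shiftedRow N μ i + s).factorial : ℝ) :=
    prod_congr rfl fun i hi => by rw [hs i hi]
  rw [inv_hookProd (length_add_rect_le hN s), inv_hookProd hN, hv, hf,
    ← prod_factorial_shiftedRow hN, prod_div_distrib]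
  have h1 : ∏ i ∈ range N, ((shiftedRow N μ i).factorial : ℝ) ≠ 0 :=
    prod_ne_zero_iff.2 fun i _ => by positivity
  field_simp

theorem length_bot : length ⊥ = 0 := by
  have := rowLen_eq_zero_iff.1 (rowLen_bot 0)
  omega

theorem hookProd_bot : hookProd ⊥ = 1 := by simp [hookProd]

theorem inv_hookProd_rect (k N : ℕ) : (hookProd (rect k N) : ℝ)⁻¹ = baseWeight N k := by
  have h := inv_hookProd_add_rect (μ := ⊥) (N := N) (by rw [length_bot]; exact Nat.zero_le _) k
  rw [bot_add, hookProd_bot, contentRatio_bot] at h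
  simpa using h

/-! ### The diagram glued from a rectangle and two partitions -/

theorem hookLength_transpose (μ : YoungDiagram) (c : ℕ × ℕ) :
    hookLength μ.transpose c = hookLength μ c.swap := by
  simp only [hookLength, YoungDiagram.rowLen_transpose, YoungDiagram.colLen_transpose,
    Prod.fst_swap, Prod.snd_swap]
  omega

theorem hookProd_transpose (μ : YoungDiagram) : hookProd μ.transpose = hookProd μ := by
  unfold hookProd
  refine prod_bij' (fun c _ => c.swap) (fun c _ => c.swap) ?_ ?_ ?_ ?_ ?_
  · intro c hc
    rwa [YoungDiagram.mem_cells, YoungDiagram.mem_transpose] at hc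
  · intro c hc
    rwa [YoungDiagram.mem_cells, YoungDiagram.mem_transpose, Prod.swap_swap]
  · intro c _; exact Prod.swap_swap c
  · intro c _; exact Prod.swap_swap c
  · intro c _; exact hookLength_transpose μ c

theorem colLen_add_rect {κ : YoungDiagram} {m : ℕ} (hκ : length κ ≤ m) (n j : ℕ) :
    (add κ (rect n m)).colLen j = if j < n then m else κ.colLen (j - n) := by
  refine eq_of_forall_lt_iff fun i => ?_
  rw [← lt_rowLen_iff_lt_colLen, rowLen_add, rowLen_rect]
  have h0 : ¬ i < m → κ.rowLen i = 0 := fun h => rowLen_eq_zero_iff.2 (by omega)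
  have h1 := lt_rowLen_iff_lt_colLen (μ := κ) (i := i) (j := j - n)
  split_ifs with hi hj <;> omega

theorem colLen_union_transpose (κ ν : YoungDiagram) (j : ℕ) :
    (union κ ν.transpose).colLen j = κ.colLen j + ν.rowLen j := by
  rw [union, YoungDiagram.colLen_transpose, rowLen_add, YoungDiagram.transpose_transpose,
    YoungDiagram.rowLen_transpose]

/-- The hook lengths of the diagram made of an `m × n` rectangle with `κ` on its right and `ν'`
below it. -/
theorem hookProd_union {κ ν : YoungDiagram} {m n : ℕ} (hκ : length κ ≤ m) (hν : length ν ≤ n) :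
    hookProd (union (add κ (rect n m)) ν.transpose) =
      (∏ i ∈ range m, ∏ j ∈ range n,
        ((m - 1 - i) + (n - 1 - j) + 1 + (κ.rowLen i + ν.rowLen j))) *
      hookProd κ * hookProd ν := by
  set B := union (add κ (rect n m)) ν.transpose with hB
  have hν0 : ∀ j, ¬ j < n → ν.rowLen j = 0 := fun j h => rowLen_eq_zero_iff.2 (by omega)
  have hcol : ∀ j, B.colLen j = if j < n then m + ν.rowLen j else κ.colLen (j - n) := by
    intro j
    rw [hB, colLen_union_transpose, colLen_add_rect hκ]
    have := hν0 j
    split_ifs with hj <;> omega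
  have hνc : ∀ k, ν.colLen k ≤ n := fun k => (ν.colLen_anti 0 k (Nat.zero_le _)).trans hν
  have hκc : ∀ k, κ.colLen k ≤ m := fun k => (κ.colLen_anti 0 k (Nat.zero_le _)).trans hκ
  have hrow : ∀ i, B.rowLen i = if i < m then n + κ.rowLen i else ν.colLen (i - m) := by
    intro i
    refine eq_of_forall_lt_iff fun j => ?_
    rw [lt_rowLen_iff_lt_colLen, hcol]
    have h1 := lt_rowLen_iff_lt_colLen (μ := κ) (i := i) (j := j - n)
    have h2 := lt_rowLen_iff_lt_colLen (μ := ν) (i := j) (j := i - m)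
    have h3 := hνc (i - m)
    have h4 := hκc (j - n)
    split_ifs with hj hi <;> omega
  have hlen : length B ≤ m + ν.rowLen 0 := by
    rw [length_le_iff, hrow, if_neg (by omega)]
    have h2 := lt_rowLen_iff_lt_colLen (μ := ν) (i := 0) (j := ν.rowLen 0)
    rw [Nat.add_sub_cancel_left]
    omega
  have hlenν : length ν.transpose ≤ ν.rowLen 0 := by
    rw [length, YoungDiagram.colLen_transpose]
  rw [← hookProd_transpose ν, hookProd, hookProd, hookProd,
    prod_cells hlen (fun i j => hookLength B (i, j)),
    prod_cells hκ (fun i j => hookLength κ (i, j)),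
    prod_cells hlenν (fun i j => hookLength ν.transpose (i, j)), prod_range_add,
    ← prod_mul_distrib]
  -- Rows i < m are cut at column n into rectangle boxes and boxes of κ. Rows m + k are those of ν',
  -- whose hooks do not see the rectangle above.
  congr 1
  · refine prod_congr rfl fun i hi => ?_
    rw [mem_range] at hi
    rw [hrow, if_pos hi, prod_range_add]
    congr 1
    · refine prod_congr rfl fun j hj => ?_
      rw [mem_range] at hj
      simp only [hookLength, hrow, hcol, if_pos hi, if_pos hj]
      omega
    · refine prod_congr rfl fun j _ => ?_
      simp only [hookLength, hrow, hcol, if_pos hi, if_neg (show ¬ n + j < n by omega),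
        Nat.add_sub_cancel_left]
      omega
  · refine prod_congr rfl fun k _ => ?_
    rw [hrow, if_neg (by omega), Nat.add_sub_cancel_left, YoungDiagram.rowLen_transpose]
    refine prod_congr rfl fun j hj => ?_
    rw [mem_range] at hj
    have := hνc k
    simp only [hookLength, hrow, hcol, if_neg (show ¬ m + k < m by omega),
      if_pos (show j < n by omega), Nat.add_sub_cancel_left, YoungDiagram.rowLen_transpose,
      YoungDiagram.colLen_transpose]
    omega

/-- The hook length of the box `(i, j)` of the rectangle with `m` rows and `n + s` columns. -/
def rectHook (m n s i j : ℕ) : ℕ := (m - 1 - i) + (n - 1 - j) + 1 + s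

theorem rectHook_pos (m n s i j : ℕ) : (0 : ℝ) < rectHook m n s i j := by
  unfold rectHook
  positivity

/-- The effect of `μ` and `ν` on the hook lengths in the `m × n` rectangle. -/
noncomputable def interaction (m n s : ℕ) (μ ν : YoungDiagram) : ℝ :=
  ∏ i ∈ range m, ∏ j ∈ range n,
    (rectHook m n s i j : ℝ) / (rectHook m n s i j + μ.rowLen i + ν.rowLen j)

theorem interaction_nonneg (m n s : ℕ) (μ ν : YoungDiagram) : 0 ≤ interaction m n s μ ν :=
  prod_nonneg fun _ _ => prod_nonneg fun _ _ => by positivity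

theorem interaction_le_one (m n s : ℕ) (μ ν : YoungDiagram) : interaction m n s μ ν ≤ 1 :=
  prod_le_one (fun _ _ => prod_nonneg fun _ _ => by positivity) fun i _ =>
    prod_le_one (fun _ _ => by positivity) fun j _ =>
      div_le_one_of_le₀ (by rw [add_assoc]; exact le_add_of_nonneg_right (by positivity))
        (by positivity)

/-- Equivalent to h((m^n)) / (h((s^n)) h(((n+s)^m))) = 1 / h((s^(m+n))): the factor h((m^n)) in Q
makes Q(∅, ∅) = P(∅). -/
theorem baseWeight_mul_baseWeight (m n s : ℕ) :
    baseWeight m s * baseWeight n s =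
      baseWeight (m + n) s * baseWeight n m * ∏ i ∈ range m, ∏ j ∈ range n,
        (rectHook m n s i j : ℝ) := by
  have h1 : ∏ i ∈ range m, ∏ j ∈ range n, (rectHook m n s i j : ℝ) =
      ∏ a ∈ range m, ((a + s + n).factorial : ℝ) / ((a + s).factorial : ℝ) := by
    rw [← prod_range_reflect (fun a => ((a + s + n).factorial : ℝ) / ((a + s).factorial : ℝ))]
    refine prod_congr rfl fun i _ => ?_
    rw [factorial_add_eq_prod, mul_div_cancel_left₀ _ (by positivity), ← prod_range_reflect]
    refine prod_congr rfl fun j hj => ?_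
    rw [mem_range] at hj
    have : n - 1 - (n - 1 - j) = j := by omega
    rw [rectHook, this]
    push_cast
    ring
  have h2 : baseWeight (m + n) s = (∏ a ∈ range m, (a.factorial : ℝ)) *
      (∏ b ∈ range n, ((b + m).factorial : ℝ)) / ((∏ b ∈ range n, ((b + s).factorial : ℝ)) *
        ∏ a ∈ range m, ((a + s + n).factorial : ℝ)) := by
    rw [baseWeight, prod_div_distrib, prod_range_add, add_comm m n, prod_range_add]
    congr 2
    · exact prod_congr rfl fun b _ => by rw [add_comm]
    · exact prod_congr rfl fun b _ => by rw [add_comm n b, add_right_comm]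
  rw [h1, h2, baseWeight, baseWeight, baseWeight]
  simp only [prod_div_distrib]
  have k1 : ∀ (N : ℕ) (f : ℕ → ℕ), ∏ a ∈ range N, ((f a).factorial : ℝ) ≠ 0 := fun N f =>
    prod_ne_zero_iff.2 fun i _ => by positivity
  have a1 := k1 m fun a => a
  have a2 := k1 m fun a => a + s
  have a3 := k1 m fun a => a + s + n
  have a4 := k1 n fun a => a
  have a5 := k1 n fun a => a + s
  have a6 := k1 n fun a => a + m
  field_simp

/-! ### Reduction to unnormalized measures with a common normalizer -/

/-- The unnormalized measure proportional to `P m n s`. -/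
noncomputable def weightRatio (m n s : ℕ) (lam : YoungDiagram) : ℝ :=
  if length lam ≤ m + n then contentRatio (m + n) (m + n + s) lam / (hookProd lam : ℝ) ^ 2 else 0

/-- The unnormalized measure proportional to `Q m n s`. -/
noncomputable def pairRatio (m n s : ℕ) (x : YoungDiagram × YoungDiagram) : ℝ :=
  if length x.1 ≤ m ∧ length x.2 ≤ n then
    contentRatio m (m + s) x.1 * contentRatio n (n + s) x.2 * interaction m n s x.1 x.2 /
      ((hookProd x.1 : ℝ) ^ 2 * (hookProd x.2 : ℝ) ^ 2)
  else 0

theorem weight_eq (m n s : ℕ) (lam : YoungDiagram) :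
    weight m n s lam = baseWeight (m + n) s * weightRatio m n s lam := by
  unfold weight weightRatio
  split_ifs with h
  · rw [one_div, mul_inv, inv_hookProd_add_rect h]
    ring
  · rw [mul_zero]

theorem Z_eq (m n s : ℕ) : Z m n s = baseWeight (m + n) s * ∑' lam, weightRatio m n s lam := by
  rw [Z, ← tsum_mul_left]
  exact tsum_congr fun lam => weight_eq m n s lam

theorem P_eq (m n s : ℕ) (lam : YoungDiagram) :
    P m n s lam = weightRatio m n s lam / ∑' lam, weightRatio m n s lam := by
  rw [P, weight_eq, Z_eq, mul_div_mul_left _ _ (baseWeight_pos _ _).ne']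

theorem Q_eq (m n s : ℕ) (x : YoungDiagram × YoungDiagram) :
    Q m n s x = pairRatio m n s x / ∑' lam, weightRatio m n s lam := by
  unfold Q pairRatio
  split_ifs with h
  · obtain ⟨h1, h2⟩ := h
    have hI : ((∏ i ∈ range m, ∏ j ∈ range n, ((m - 1 - i) + (n - 1 - j) + 1 +
        ((add x.1 (rect s m)).rowLen i + x.2.rowLen j)) : ℕ) : ℝ)⁻¹ =
        interaction m n s x.1 x.2 / ∏ i ∈ range m, ∏ j ∈ range n, (rectHook m n s i j : ℝ) := by
      push_cast
      simp only [interaction, ← prod_div_distrib, ← prod_inv_distrib]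
      refine prod_congr rfl fun i hi => prod_congr rfl fun j _ => ?_
      rw [mem_range] at hi
      have h0 := (rectHook_pos m n s i j).ne'
      rw [rowLen_add, rowLen_rect, if_pos hi, div_right_comm, div_self h0, one_div]
      congr 1
      unfold rectHook
      push_cast
      ring
    have hb := baseWeight_mul_baseWeight m n s
    have hz : ∏ i ∈ range m, ∏ j ∈ range n, (rectHook m n s i j : ℝ) ≠ 0 :=
      prod_ne_zero_iff.2 fun i _ => prod_ne_zero_iff.2 fun j _ => (rectHook_pos m n s i j).ne'
    have hp := (baseWeight_pos (m + n) s).ne'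
    have hq := (baseWeight_pos n m).ne'
    rw [hookProd_union (length_add_rect_le h1 s) h2, Z_eq, div_eq_mul_inv, Nat.cast_mul,
      Nat.cast_mul]
    simp only [mul_inv]
    rw [hI, inv_hookProd_add_rect h1, inv_hookProd_add_rect h2,
      ← inv_inv (hookProd (rect m n) : ℝ), inv_hookProd_rect]
    set A := ∏ i ∈ range m, ∏ j ∈ range n, (rectHook m n s i j : ℝ)
    -- The constants are gathered into one quotient, equal to 1 by `hb`.
    calc _ = (baseWeight m s * baseWeight n s) / (baseWeight (m + n) s * baseWeight n m * A) *
          (contentRatio m (m + s) x.1 * contentRatio n (n + s) x.2 * interaction m n s x.1 x.2 /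
      ((hookProd x.1 : ℝ) ^ 2 * (hookProd x.2 : ℝ) ^ 2) / ∑' lam, weightRatio m n s lam) := by
            simp only [div_eq_mul_inv, mul_inv]
            ring
      _ = _ := by rw [hb, div_self (by positivity), one_mul]
  · rw [zero_div]

/-! ### Asymptotic factorization of the interaction -/

/-- After cross-multiplication both sides are ∏ (C + j) over j < n + p. It trades a product over the
n columns of the rectangle for one over p boxes. -/
theorem prod_div_add_eq {C : ℝ} (hC : 0 < C) (n p : ℕ) :
    ∏ j ∈ range n, (C + j) / (C + j + p) = ∏ a ∈ range p, (C + a) / (C + n + a) := by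
  have h1 : (∏ j ∈ range n, (C + j)) * ∏ a ∈ range p, (C + n + a) =
      ∏ j ∈ range (n + p), (C + j) := by
    rw [prod_range_add]
    congr 1
    exact prod_congr rfl fun a _ => by push_cast; ring
  have h2 : (∏ a ∈ range p, (C + a)) * ∏ j ∈ range n, (C + j + p) =
      ∏ j ∈ range (n + p), (C + j) := by
    rw [add_comm n p, prod_range_add]
    congr 1
    exact prod_congr rfl fun a _ => by push_cast; ring
  rw [prod_div_distrib, prod_div_distrib, div_eq_div_iff, h1, h2]
  · exact prod_ne_zero_iff.2 fun i _ => by positivity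
  · exact prod_ne_zero_iff.2 fun i _ => by positivity

/-- In row i the interaction telescopes to ∏ (m + s - i + a) / (m + n + s - i + a) over the boxes a
of that row, and its numerators cancel the old denominators. -/
theorem contentRatio_mul_interaction {μ : YoungDiagram} {m : ℕ} (hμ : length μ ≤ m) (n s : ℕ) :
    contentRatio m (m + s) μ * interaction m n s μ ⊥ = contentRatio m (m + n + s) μ := by
  rw [contentRatio_eq hμ, contentRatio_eq hμ, interaction, ← prod_mul_distrib]
  refine prod_congr rfl fun i hi => ?_
  rw [mem_range] at hi
  have hC : (0 : ℝ) < (m : ℝ) + s - i := by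
    have : (i : ℝ) < m := by exact_mod_cast hi
    have h2 : (0 : ℝ) ≤ s := by positivity
    linarith
  have e : ∏ j ∈ range n, (rectHook m n s i j : ℝ) /
      (rectHook m n s i j + μ.rowLen i + (⊥ : YoungDiagram).rowLen j) =
      ∏ j ∈ range n, ((m : ℝ) + s - i + j) / ((m : ℝ) + s - i + j + μ.rowLen i) := by
    rw [← prod_range_reflect
      (fun j : ℕ => ((m : ℝ) + s - i + j) / ((m : ℝ) + s - i + j + μ.rowLen i))]
    refine prod_congr rfl fun j hj => ?_
    rw [mem_range] at hj
    have : (rectHook m n s i j : ℝ) = (m : ℝ) + s - i + (n - 1 - j : ℕ) := by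
      rw [rectHook, Nat.sub_sub m, Nat.cast_add, Nat.cast_add, Nat.cast_add,
        Nat.cast_sub (show 1 + i ≤ m by omega)]
      push_cast
      ring
    rw [this, rowLen_bot, Nat.cast_zero, add_zero]
  rw [e, prod_div_add_eq hC, ← prod_mul_distrib]
  refine prod_congr rfl fun a _ => ?_
  have h1 : ((m + s : ℕ) : ℝ) - i + a = (m : ℝ) + s - i + a := by push_cast; ring
  have h2 : ((m + n + s : ℕ) : ℝ) - i + a = (m : ℝ) + s - i + n + a := by push_cast; ring
  have h3 : (m : ℝ) + s - i + a ≠ 0 := by positivity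
  rw [h1, h2, div_mul_div_cancel₀ h3]

theorem interaction_swap (m n s : ℕ) (μ ν : YoungDiagram) :
    interaction m n s μ ν = interaction n m s ν μ := by
  rw [interaction, Finset.prod_comm, interaction]
  refine prod_congr rfl fun j _ => prod_congr rfl fun i _ => ?_
  rw [add_right_comm, show rectHook m n s i j = rectHook n m s j i by unfold rectHook; omega]

/-- The deviation of `interaction` from multiplicativity. -/
theorem interaction_eq {μ ν : YoungDiagram} {m n : ℕ} (hμ : length μ ≤ m) (hν : length ν ≤ n)
    (s : ℕ) :
    interaction m n s μ ν = interaction m n s μ ⊥ * interaction m n s ⊥ ν *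
      ∏ i ∈ range (length μ), ∏ j ∈ range (length ν),
        (1 + μ.rowLen i * (rectHook m n s i j : ℝ)⁻¹) *
          (1 - μ.rowLen i * (rectHook m n s i j + μ.rowLen i + ν.rowLen j : ℝ)⁻¹) := by
  -- With r the rectangle hook, a = μ_i and b = ν_j, the factor is (r + a)(r + b) / (r (r + a + b)),
  -- which is 1 as soon as a or b is zero. Only l(μ) l(ν) factors survive, whatever m and n are.
  have hsub : ∏ i ∈ range (length μ), ∏ j ∈ range (length ν),
        (1 + μ.rowLen i * (rectHook m n s i j : ℝ)⁻¹) *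
          (1 - μ.rowLen i * (rectHook m n s i j + μ.rowLen i + ν.rowLen j : ℝ)⁻¹) =
      ∏ i ∈ range m, ∏ j ∈ range n,
        (1 + μ.rowLen i * (rectHook m n s i j : ℝ)⁻¹) *
          (1 - μ.rowLen i * (rectHook m n s i j + μ.rowLen i + ν.rowLen j : ℝ)⁻¹) := by
    rw [← prod_subset (range_subset_range.2 hμ) (fun i _ hi => ?_)]
    · refine prod_congr rfl fun i _ => prod_subset (range_subset_range.2 hν) fun j _ hj => ?_
      have h0 : ν.rowLen j = 0 := rowLen_eq_zero_iff.2 (by simpa using hj)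
      have h1 := rectHook_pos m n s i j
      rw [h0]
      push_cast
      field_simp
      ring
    · have h0 : μ.rowLen i = 0 := rowLen_eq_zero_iff.2 (by simpa using hi)
      exact prod_eq_one fun j _ => by rw [h0]; simp
  rw [hsub, interaction, interaction, interaction, ← prod_mul_distrib, ← prod_mul_distrib]
  refine prod_congr rfl fun i _ => ?_
  rw [← prod_mul_distrib, ← prod_mul_distrib]
  refine prod_congr rfl fun j _ => ?_
  have h1 := rectHook_pos m n s i j
  rw [rowLen_bot, rowLen_bot]
  push_cast
  field_simp
  ring

/-! ### Domination -/

theorem weightRatio_nonneg (m n s : ℕ) (lam : YoungDiagram) : 0 ≤ weightRatio m n s lam := by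
  unfold weightRatio
  split_ifs with h
  · exact div_nonneg (contentRatio_nonneg h (by omega)) (by positivity)
  · exact le_rfl

theorem weightRatio_le (m n s : ℕ) (lam : YoungDiagram) :
    weightRatio m n s lam ≤ 1 / (hookProd lam : ℝ) ^ 2 := by
  unfold weightRatio
  split_ifs with h
  · exact div_le_div_of_nonneg_right (contentRatio_le_one h (by omega)) (by positivity)
  · positivity

theorem pairRatio_nonneg (m n s : ℕ) (x : YoungDiagram × YoungDiagram) :
    0 ≤ pairRatio m n s x := by
  unfold pairRatio
  split_ifs with h
  · exact div_nonneg (mul_nonneg (mul_nonneg (contentRatio_nonneg h.1 (by omega))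
      (contentRatio_nonneg h.2 (by omega))) (interaction_nonneg _ _ _ _ _)) (by positivity)
  · exact le_rfl

theorem pairRatio_le (m n s : ℕ) (x : YoungDiagram × YoungDiagram) :
    pairRatio m n s x ≤ 1 / (hookProd x.1 : ℝ) ^ 2 * (1 / (hookProd x.2 : ℝ) ^ 2) := by
  unfold pairRatio
  split_ifs with h
  · rw [div_mul_div_comm, one_mul]
    refine div_le_div_of_nonneg_right ?_ (by positivity)
    have h1 := contentRatio_nonneg h.1 (show m ≤ m + s by omega)
    have h2 := contentRatio_nonneg h.2 (show n ≤ n + s by omega)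
    exact mul_le_one₀ (mul_le_one₀ (contentRatio_le_one h.1 (by omega)) h2
      (contentRatio_le_one h.2 (by omega))) (interaction_nonneg _ _ _ _ _)
      (interaction_le_one _ _ _ _ _)
  · positivity

theorem summable_one_div_hookProd_sq :
    Summable (fun μ : YoungDiagram => 1 / (hookProd μ : ℝ) ^ 2) := by
  simpa using (hasSum_pow_card_div zero_le_one).summable

theorem summable_weightRatio (m n s : ℕ) : Summable (weightRatio m n s) :=
  summable_one_div_hookProd_sq.of_nonneg_of_le (weightRatio_nonneg m n s) (weightRatio_le m n s)

theorem tsum_weightRatio_pos (m n s : ℕ) : 0 < ∑' lam, weightRatio m n s lam := by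
  refine (summable_weightRatio m n s).tsum_pos (weightRatio_nonneg m n s) ⊥ ?_
  rw [weightRatio, if_pos (by rw [length_bot]; exact Nat.zero_le _), contentRatio_bot,
    hookProd_bot]
  simp

/-! ### Limits -/

section Limits

variable {ι : Type*} {l : Filter ι}

theorem tendsto_contentRatio {u v : ι → ℕ} (hu : Tendsto u l atTop) (hv : Tendsto v l atTop)
    {c : ℝ} (huv : Tendsto (fun i => (u i : ℝ) / v i) l (𝓝 c)) (μ : YoungDiagram) :
    Tendsto (fun i => contentRatio (u i) (v i) μ) l (𝓝 (c ^ μ.card)) := by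
  rw [YoungDiagram.card, ← prod_const]
  refine tendsto_finsetProd _ fun x _ => ?_
  have hinv : ∀ {w : ι → ℕ}, Tendsto w l atTop → Tendsto (fun i => (w i : ℝ)⁻¹) l (𝓝 0) :=
    fun hw => tendsto_inv_atTop_zero.comp (tendsto_natCast_atTop_atTop.comp hw)
  have h1 : Tendsto (fun i => (u i : ℝ) / v i * (1 + ((x.2 : ℝ) - x.1) * (u i : ℝ)⁻¹) /
      (1 + ((x.2 : ℝ) - x.1) * (v i : ℝ)⁻¹)) l (𝓝 (c * (1 + ((x.2 : ℝ) - x.1) * 0) /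
      (1 + ((x.2 : ℝ) - x.1) * 0))) :=
    (huv.mul (((hinv hu).const_mul _).const_add _)).div (((hinv hv).const_mul _).const_add _)
      (by simp)
  rw [mul_zero, add_zero, mul_one, div_one] at h1
  refine h1.congr' ?_
  filter_upwards [hu.eventually_gt_atTop 0, hv.eventually_gt_atTop 0] with i h2 h3
  have h2' : (u i : ℝ) ≠ 0 := by positivity
  have h3' : (v i : ℝ) ≠ 0 := by positivity
  have e1 : 1 + ((x.2 : ℝ) - x.1) * (u i : ℝ)⁻¹ = ((u i : ℝ) - x.1 + x.2) / u i := by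
    field_simp; ring
  have e2 : 1 + ((x.2 : ℝ) - x.1) * (v i : ℝ)⁻¹ = ((v i : ℝ) - x.1 + x.2) / v i := by
    field_simp; ring
  rw [e1, e2, div_mul_div_comm, mul_comm (v i : ℝ), mul_div_mul_left _ _ h2',
    div_div_div_cancel_right₀ h3']

theorem tendsto_weightRatio {m n s : ι → ℕ} (hm : Tendsto m l atTop) {t : ℝ}
    (ht : Tendsto (fun i => ((m i : ℝ) + n i) / (m i + n i + s i)) l (𝓝 t)) (lam : YoungDiagram) :
    Tendsto (fun i => weightRatio (m i) (n i) (s i) lam) l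
      (𝓝 (t ^ lam.card / (hookProd lam : ℝ) ^ 2)) := by
  have hu : Tendsto (fun i => m i + n i) l atTop :=
    tendsto_atTop_mono (fun i => Nat.le_add_right _ _) hm
  have hv : Tendsto (fun i => m i + n i + s i) l atTop :=
    tendsto_atTop_mono (fun i => Nat.le_add_right _ _) hu
  have h := (tendsto_contentRatio hu hv (by exact_mod_cast ht) lam).div_const
    ((hookProd lam : ℝ) ^ 2)
  refine h.congr' ?_
  filter_upwards [hu.eventually_ge_atTop (length lam)] with i hi
  rw [weightRatio, if_pos hi]

theorem tendsto_pairRatio {m n s : ι → ℕ} (hm : Tendsto m l atTop) (hn : Tendsto n l atTop)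
    {γ δ : ℝ} (hγ : Tendsto (fun i => (m i : ℝ) / (m i + n i + s i)) l (𝓝 γ))
    (hδ : Tendsto (fun i => (n i : ℝ) / (m i + n i + s i)) l (𝓝 δ))
    (x : YoungDiagram × YoungDiagram) :
    Tendsto (fun i => pairRatio (m i) (n i) (s i) x) l
      (𝓝 (γ ^ x.1.card / (hookProd x.1 : ℝ) ^ 2 * (δ ^ x.2.card / (hookProd x.2 : ℝ) ^ 2))) := by
  obtain ⟨μ, ν⟩ := x
  have hv : Tendsto (fun i => m i + n i + s i) l atTop :=
    tendsto_atTop_mono (fun i => by omega) hm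
  have h1 := tendsto_contentRatio hm hv (by exact_mod_cast hγ) μ
  have h2 := tendsto_contentRatio hn hv (by exact_mod_cast hδ) ν
  have hB : ∀ a b : ℕ, Tendsto (fun i => (rectHook (m i) (n i) (s i) a b : ℝ)) l atTop := by
    intro a b
    refine tendsto_natCast_atTop_atTop.comp
      (tendsto_atTop_mono (fun i => ?_) ((tendsto_sub_atTop_nat (1 + a)).comp hm))
    simp only [rectHook, Function.comp]
    omega
  have h3 : Tendsto (fun i => ∏ a ∈ range (length μ), ∏ b ∈ range (length ν),
        (1 + μ.rowLen a * (rectHook (m i) (n i) (s i) a b : ℝ)⁻¹) *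
          (1 - μ.rowLen a *
            (rectHook (m i) (n i) (s i) a b + μ.rowLen a + ν.rowLen b : ℝ)⁻¹)) l (𝓝 1) := by
    have hone : ∏ a ∈ range (length μ), ∏ b ∈ range (length ν),
        (1 + (μ.rowLen a : ℝ) * 0) * (1 - (μ.rowLen a : ℝ) * 0) = 1 := by simp
    refine Eq.subst (motive := fun c => Tendsto _ l (𝓝 c)) hone ?_
    refine tendsto_finsetProd _ fun a _ => tendsto_finsetProd _ fun b _ => ?_
    refine (((tendsto_inv_atTop_zero.comp (hB a b)).const_mul _).const_add _).mul
      (((tendsto_inv_atTop_zero.comp ?_).const_mul _).const_sub _)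
    exact tendsto_atTop_add_const_right _ _ (tendsto_atTop_add_const_right _ _ (hB a b))
  have h4 := ((h1.mul h2).mul h3).div_const ((hookProd μ : ℝ) ^ 2 * (hookProd ν : ℝ) ^ 2)
  rw [mul_one, ← div_mul_div_comm] at h4
  refine h4.congr' ?_
  filter_upwards [hm.eventually_ge_atTop (length μ), hn.eventually_ge_atTop (length ν)]
    with i hi hj
  -- The swap puts ν in the first slot, so that both content ratios acquire the denominator
  -- parameter m + n + s.
  rw [pairRatio, if_pos ⟨hi, hj⟩, interaction_eq hi hj, ← contentRatio_mul_interaction hi,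
    interaction_swap _ _ _ ⊥ ν, add_comm (m i) (n i), ← contentRatio_mul_interaction hj]
  ring

/-- Dominated convergence for sums. The normalizers z need not be the masses of g; only their limit
must be the mass of G, which is what Q requires. -/
theorem convergesInDistribution_of_dominated {X : Type*} {g : ι → X → ℝ} {G bound : X → ℝ}
    {z : ι → ℝ} {ζ : ℝ} (hbound : Summable bound) (hg0 : ∀ i x, 0 ≤ g i x)
    (hgb : ∀ i x, g i x ≤ bound x) (hg : ∀ x, Tendsto (fun i => g i x) l (𝓝 (G x)))
    (hG0 : ∀ x, 0 ≤ G x) (hG : HasSum G ζ) (hz0 : ∀ i, 0 < z i) (hζ : 0 < ζ)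
    (hz : Tendsto z l (𝓝 ζ)) :
    ConvergesInDistribution l (fun i x => g i x / z i) (fun x => G x / ζ) := by
  refine ⟨fun i => ⟨fun x => div_nonneg (hg0 i x) (hz0 i).le,
    (hbound.of_nonneg_of_le (hg0 i) (hgb i)).div_const _⟩,
    ⟨fun x => div_nonneg (hG0 x) hζ.le, ?_⟩, ?_⟩
  · have := hG.div_const ζ
    rwa [div_self hζ.ne'] at this
  · rintro f ⟨C, hC⟩
    have key : Tendsto (fun i => ∑' x, f x * g i x) l (𝓝 (∑' x, f x * G x)) := by
      refine tendsto_tsum_of_dominated_convergence (hbound.mul_left C)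
        (fun x => (hg x).const_mul _) (Eventually.of_forall fun i x => ?_)
      rw [norm_mul, Real.norm_eq_abs, Real.norm_of_nonneg (hg0 i x)]
      exact mul_le_mul (hC x) (hgb i x) (hg0 i x) ((abs_nonneg _).trans (hC x))
    have : Tendsto (fun i => (∑' x, f x * g i x) / z i) l (𝓝 ((∑' x, f x * G x) / ζ)) :=
      key.div hz hζ.ne'
    simpa only [← mul_div_assoc, tsum_div_const] using this

theorem poissonPlancherel_eq (t : ℝ) (lam : YoungDiagram) :
    poissonPlancherel t lam = t ^ lam.card / (hookProd lam : ℝ) ^ 2 / Real.exp t := by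
  rw [poissonPlancherel, Real.exp_neg]
  field_simp

/-- Multiply numerator and denominator by s / (m n): the denominator becomes (s/m)(s/n) + s/m + s/n,
and the numerators become s/n and s/m. -/
theorem tendsto_ratios {m n s : ι → ℕ} (hm : Tendsto m l atTop) (hn : Tendsto n l atTop)
    {α β : ℝ} (hs : Tendsto s l atTop) (hα : Tendsto (fun i => (s i : ℝ) / m i) l (𝓝 α))
    (hβ : Tendsto (fun i => (s i : ℝ) / n i) l (𝓝 β)) (hD : α * β + α + β ≠ 0) :
    Tendsto (fun i => (m i : ℝ) / (m i + n i + s i)) l (𝓝 (β / (α * β + α + β))) ∧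
      Tendsto (fun i => (n i : ℝ) / (m i + n i + s i)) l (𝓝 (α / (α * β + α + β))) := by
  have hden := ((hα.mul hβ).add hα).add hβ
  constructor
  · refine (hβ.div hden hD).congr' ?_
    filter_upwards [hm.eventually_gt_atTop 0, hn.eventually_gt_atTop 0, hs.eventually_gt_atTop 0]
      with i h1 h2 h3
    have h1' : (0 : ℝ) < m i := by exact_mod_cast h1
    have h2' : (0 : ℝ) < n i := by exact_mod_cast h2
    have h3' : (0 : ℝ) < s i := by exact_mod_cast h3
    simp only [Pi.div_apply]
    field_simp
    ring
  · refine (hα.div hden hD).congr' ?_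
    filter_upwards [hm.eventually_gt_atTop 0, hn.eventually_gt_atTop 0, hs.eventually_gt_atTop 0]
      with i h1 h2 h3
    have h1' : (0 : ℝ) < m i := by exact_mod_cast h1
    have h2' : (0 : ℝ) < n i := by exact_mod_cast h2
    have h3' : (0 : ℝ) < s i := by exact_mod_cast h3
    simp only [Pi.div_apply]
    field_simp
    ring

theorem tendsto_ratio_of_negligible {m n s : ι → ℕ} (hm : Tendsto m l atTop)
    (hα : Tendsto (fun i => (s i : ℝ) / m i) l (𝓝 0)) {u : ι → ℕ} {c : ℝ}
    (hu : Tendsto (fun i => (u i : ℝ) / (m i + n i)) l (𝓝 c)) :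
    Tendsto (fun i => (u i : ℝ) / (m i + n i + s i)) l (𝓝 c) := by
  have h0 : Tendsto (fun i => (s i : ℝ) / (m i + n i)) l (𝓝 0) := by
    refine tendsto_of_tendsto_of_tendsto_of_le_of_le' tendsto_const_nhds hα
      (Eventually.of_forall fun i => by positivity) ?_
    filter_upwards [hm.eventually_gt_atTop 0] with i h1
    have h1' : (0 : ℝ) < m i := by exact_mod_cast h1
    exact div_le_div_of_nonneg_left (by positivity) h1' (le_add_of_nonneg_right (by positivity))
  have h1 := hu.div (h0.const_add 1) (by simp)
  rw [add_zero, div_one] at h1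
  refine h1.congr' ?_
  filter_upwards [hm.eventually_gt_atTop 0] with i h1
  have h1' : (0 : ℝ) < m i := by exact_mod_cast h1
  have h2' : (0 : ℝ) < (m i : ℝ) + n i := by positivity
  have e : 1 + (s i : ℝ) / (m i + n i) = (m i + n i + s i) / (m i + n i) := by
    field_simp
  rw [Pi.div_apply, e, div_div_div_cancel_right₀ h2'.ne']

end Limits

end RandomPartition

theorem mainTheorem4 {ι : Type*} (l : Filter ι) [l.NeBot] (m n s : ι → ℕ)
    (hm : Tendsto m l atTop) (hn : Tendsto n l atTop) (γ δ : ℝ)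
    (hlim :
      -- `s → ∞` with `s / m → α` and `s / n → β`, where `α` and `β` are not both zero
      (Tendsto s l atTop ∧ ∃ α β : ℝ,
        Tendsto (fun i => (s i : ℝ) / m i) l (𝓝 α) ∧
        Tendsto (fun i => (s i : ℝ) / n i) l (𝓝 β) ∧
        ¬ (α = 0 ∧ β = 0) ∧
        γ = β / (α * β + α + β) ∧ δ = α / (α * β + α + β)) ∨
      -- `s / m → 0` and `s / n → 0` (for instance `s` constant), with the ratio of `m` to `n` fixed
      (Tendsto (fun i => (s i : ℝ) / m i) l (𝓝 0) ∧
        Tendsto (fun i => (s i : ℝ) / n i) l (𝓝 0) ∧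
        Tendsto (fun i => (m i : ℝ) / (m i + n i)) l (𝓝 γ) ∧
        Tendsto (fun i => (n i : ℝ) / (m i + n i)) l (𝓝 δ))) :
    (∀ lam : YoungDiagram,
      Tendsto (fun i => RandomPartition.P (m i) (n i) (s i) lam) l
        (𝓝 (Real.exp (-(γ + δ)) * (γ + δ) ^ lam.card /
          (RandomPartition.hookProd lam : ℝ) ^ 2))) ∧
    (∀ μ ν : YoungDiagram,
      Tendsto (fun i => RandomPartition.Q (m i) (n i) (s i) (μ, ν)) l
        (𝓝 (Real.exp (-(γ + δ)) * γ ^ μ.card * δ ^ ν.card /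
          ((RandomPartition.hookProd μ : ℝ) ^ 2 * (RandomPartition.hookProd ν : ℝ) ^ 2)))) ∧
    (∀ i, HasSum (RandomPartition.P (m i) (n i) (s i)) 1) ∧
    RandomPartition.ConvergesInDistribution l
      (fun i => RandomPartition.P (m i) (n i) (s i))
      (RandomPartition.poissonPlancherel (γ + δ)) ∧
    RandomPartition.ConvergesInDistribution l
      (fun i => RandomPartition.Q (m i) (n i) (s i))
      (fun x => RandomPartition.poissonPlancherel γ x.1 *
        RandomPartition.poissonPlancherel δ x.2) := by
  -- Both regimes enter only through these two limits.
  open RandomPartition in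
  have hratio : Tendsto (fun i => (m i : ℝ) / (m i + n i + s i)) l (𝓝 γ) ∧
      Tendsto (fun i => (n i : ℝ) / (m i + n i + s i)) l (𝓝 δ) := by
    rcases hlim with ⟨hs, α, β, hα, hβ, hne, rfl, rfl⟩ | ⟨hα, _, h1, h2⟩
    -- As limits of nonnegative ratios, α and β are nonnegative, so the denominator vanishes only if
    -- both do.
    · refine tendsto_ratios hm hn hs hα hβ fun hD => hne ?_
      have hα0 : 0 ≤ α := ge_of_tendsto' hα fun i => by positivity
      have hβ0 : 0 ≤ β := ge_of_tendsto' hβ fun i => by positivity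
      have hαβ := mul_nonneg hα0 hβ0
      exact ⟨by linarith, by linarith⟩
    · exact ⟨tendsto_ratio_of_negligible hm hα h1, tendsto_ratio_of_negligible hm hα h2⟩
  obtain ⟨hγ, hδ⟩ := hratio
  have hγ0 : 0 ≤ γ := ge_of_tendsto' hγ fun i => by positivity
  have hδ0 : 0 ≤ δ := ge_of_tendsto' hδ fun i => by positivity
  have ht0 : 0 ≤ γ + δ := add_nonneg hγ0 hδ0
  have ht : Tendsto (fun i => ((m i : ℝ) + n i) / (m i + n i + s i)) l (𝓝 (γ + δ)) :=
    (hγ.add hδ).congr fun i => (add_div _ _ _).symm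
  have hw := tendsto_weightRatio hm ht
  have hp := tendsto_pairRatio hm hn hγ hδ
  have hsumw := hasSum_pow_card_div ht0
  have hz : Tendsto (fun i => ∑' lam, weightRatio (m i) (n i) (s i) lam) l
      (𝓝 (Real.exp (γ + δ))) := by
    rw [← hsumw.tsum_eq]
    refine tendsto_tsum_of_dominated_convergence summable_one_div_hookProd_sq hw
      (Filter.Eventually.of_forall fun i lam => ?_)
    rw [Real.norm_of_nonneg (weightRatio_nonneg _ _ _ _)]
    exact weightRatio_le _ _ _ _
  have hP : (fun i => P (m i) (n i) (s i)) = fun i lam =>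
      weightRatio (m i) (n i) (s i) lam / ∑' lam, weightRatio (m i) (n i) (s i) lam :=
    funext fun i => funext fun lam => P_eq _ _ _ _
  have hQ : (fun i => Q (m i) (n i) (s i)) = fun i x =>
      pairRatio (m i) (n i) (s i) x / ∑' lam, weightRatio (m i) (n i) (s i) lam :=
    funext fun i => funext fun x => Q_eq _ _ _ _
  refine ⟨fun lam => ?_, fun μ ν => ?_, fun i => ?_, ?_, ?_⟩
  · have h := (hw lam).div hz (Real.exp_ne_zero _)
    rw [← poissonPlancherel_eq] at h
    exact h.congr fun i => (P_eq _ _ _ _).symm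
  · have h := (hp (μ, ν)).div hz (Real.exp_ne_zero _)
    have e : γ ^ μ.card / (hookProd μ : ℝ) ^ 2 * (δ ^ ν.card / (hookProd ν : ℝ) ^ 2) /
        Real.exp (γ + δ) = Real.exp (-(γ + δ)) * γ ^ μ.card * δ ^ ν.card /
          ((hookProd μ : ℝ) ^ 2 * (hookProd ν : ℝ) ^ 2) := by
      rw [Real.exp_neg]
      field_simp
    rw [← e]
    exact h.congr fun i => (Q_eq _ _ _ _).symm
  · have h := (summable_weightRatio (m i) (n i) (s i)).hasSum.div_const
      (∑' lam, weightRatio (m i) (n i) (s i) lam)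
    rw [div_self (tsum_weightRatio_pos _ _ _).ne'] at h
    rw [show P (m i) (n i) (s i) = _ from congrFun hP i]
    exact h
  · rw [hP, show poissonPlancherel (γ + δ) = _ from funext (poissonPlancherel_eq (γ + δ))]
    exact convergesInDistribution_of_dominated summable_one_div_hookProd_sq
      (fun i => weightRatio_nonneg _ _ _) (fun i => weightRatio_le _ _ _) hw
      (fun lam => by positivity) hsumw (fun i => tsum_weightRatio_pos _ _ _)
      (Real.exp_pos _) hz
  · have hq : (fun x : YoungDiagram × YoungDiagram =>
        poissonPlancherel γ x.1 * poissonPlancherel δ x.2) = fun x =>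
        γ ^ x.1.card / (hookProd x.1 : ℝ) ^ 2 * (δ ^ x.2.card / (hookProd x.2 : ℝ) ^ 2) /
          Real.exp (γ + δ) := by
      funext x
      rw [poissonPlancherel_eq, poissonPlancherel_eq, div_mul_div_comm, Real.exp_add]
    have hs := summable_one_div_hookProd_sq
    have hγs := hasSum_pow_card_div hγ0
    have hδs := hasSum_pow_card_div hδ0
    have hmul := hγs.mul hδs (hγs.summable.mul_of_nonneg hδs.summable
      (fun _ => by positivity) (fun _ => by positivity))
    -- The mass e^γ e^δ of the product limit is exactly the limit of the normalizer of P.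
    rw [← Real.exp_add] at hmul
    rw [hQ, hq]
    exact convergesInDistribution_of_dominated
      (hs.mul_of_nonneg hs (fun _ => by positivity) (fun _ => by positivity))
      (fun i => pairRatio_nonneg _ _ _) (fun i => pairRatio_le _ _ _) hp
      (fun x => by positivity) hmul (fun i => tsum_weightRatio_pos _ _ _) (Real.exp_pos _) hz
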